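/- **Tight Soundness and Completeness of System $\mathcal H$.** *Calculus.* Terms, up to renaming of bound variables, are $t ::= x \mid \lambda x.t \mid t\,t \mid \mathbf 0 \mid \mathsf{succ}(t) \mid \mathsf{if}(t,t,x.t) \mid \mathsf{fix}\,x.t$, where $x$ is bound in $\lambda x.t$, in $\mathsf{fix}\,x.t$ and in the third argument $u$ of $\mathsf{if}(t,s,x.u)$. Natural values are $k ::= \mathbf 0 \mid \mathsf{succ}(k)$ and values are $v ::= \lambda x.t \mid k$. Reduction $\to_\rho$, with rule names $\rho\in\{B,I0,IS,F\}$, is generated by $(\lambda x.t)\,v\to_B t\{x\backslash v\}$; $\mathsf{if}(\mathbf 0,t,x.s)\to_{I0} t$; $\mathsf{if}(\mathsf{succ}(k),t,x.s)\to_{IS} s\{x\backslash k\}$; $\mathsf{fix}\,x.t\to_F t\{x\backslash \mathsf{fix}\,x.t\}$, closed under the contexts $\square\,s$, $t\,\square$, $\mathsf{succ}(\square)$, $\mathsf{if}(\square,s,x.u)$. The sets $\mathrm{NF}_\varepsilon$, $\varepsilon\in\{\mathsf{abs},\mathsf{nat},\mathsf{stuck}\}$, are defined inductively: $\lambda x.t\in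 \mathrm{NF}_{\mathsf{abs}}$; $\mathbf 0\in \mathrm{NF}_{\mathsf{nat}}$; $\mathsf{succ}(t)\in \mathrm{NF}_{\mathsf{nat}}$ if $t\in \mathrm{NF}_{\mathsf{nat}}$; $t\,s\in \mathrm{NF}_{\mathsf{stuck}}$ if $t\in \mathrm{NF}_{\varepsilon}$, $s\in \mathrm{NF}_{\varepsilon'}$ and $\varepsilon\ne\mathsf{abs}$; $\mathsf{succ}(t)\in \mathrm{NF}_{\mathsf{stuck}}$ and $\mathsf{if}(t,s,x.u)\in \mathrm{NF}_{\mathsf{stuck}}$ if $t\in \mathrm{NF}_\varepsilon$ and $\varepsilon\neq\mathsf{nat}$. The proper natures are $\nu\in\{\mathsf{abs},\mathsf{nat}\}$. *Types.* $\mathsf{abs}$-types are $T^?\to S$ and $\mathsf{nat}$-types are $\mathbb 0$ and $\mathbb S(N)$, where $S$ is a multitype, $N$ is a $\mathsf{nat}$-multitype, and $T^?$ is an optional multitype, that is, $\bot$ or a multitype. A $\nu$-multitype $[\tau_i]^\nu_{i\in I}$ is a finite multiset of $\nu$-types decorated with $\nu$; a multitype is an $\mathsf{abs}$- or a $\mathsf{nat}$-multitype.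 Two optional multitypes are compatible if one of them is $\bot$ or both have the same nature; the sum of compatible ones is the union of multisets, with $\bot$ neutral. A typing context $\Gamma$ assigns to each variable an optional multitype ($\bot$ for all but finitely many), and a family context $\Phi$ assigns to each variable a finite multiset of multitypes (empty for all but finitely many). Sums of contexts are pointwise, and a sum of typing contexts is formed only when they are pairwise compatible. The domains $\{x : \Phi(x)\neq\emptyset\}$ and $\{x:\Gamma(x)\ne\bot\}$ in a judgment are disjoint. Subsumption $\lhd$ is given by $\bot\lhd[\,]^\nu$ and $T\lhd T$. A multi-counter is a finite multiset of rule names. *System $\mathcal H$* derives judgments $\Phi;\Gamma\vdash^{m} t:T$ by the following rules, with $I$ ranging over finite, possibly empty sets. The contexts in the conclusion of a rule that binds $x$ do not mention $x$. - $\emptyset;\,x:T\vdash^{[\,]}x:T$ and $x:[T];\,\emptyset\vdash^{[\,]}x:T$. - If $\Phi_i;\,\Gamma_i,x:T^?_i\vdash^{m_i}t:S_i$ for all $i\in I$, then $\sum_i\Phi_i;\sum_i\Gamma_i\vdash^{\sum_i m_i}\lambda x.t:[T^?_i\to S_i]^{\mathsf{abs}}_{i\in I}$. - If $\Phi_1;\Gamma_1\vdash^{m_1}t:[T^?\to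 S]^{\mathsf{abs}}$, $T^?\lhd T$ and $\Phi_2;\Gamma_2\vdash^{m_2}s:T$, then $\Phi_1+\Phi_2;\Gamma_1+\Gamma_2\vdash^{[B]+m_1+m_2}t\,s:S$. - $\emptyset;\emptyset\vdash^{[\,]}\mathbf 0:[\mathbb 0]^{\mathsf{nat}}_{i\in I}$. - If $\Phi;\Gamma\vdash^{m}t:\sum_{i\in I}N_i$ with $\mathsf{nat}$-multitypes $N_i$ (the empty sum being $[\,]^{\mathsf{nat}}$), then $\Phi;\Gamma\vdash^m\mathsf{succ}(t):[\mathbb S(N_i)]^{\mathsf{nat}}_{i\in I}$. - If $\Phi_1;\Gamma_1\vdash^{m_1}t:[\mathbb 0]^{\mathsf{nat}}$ and $\Phi_2;\Gamma_2\vdash^{m_2}s:T$, then $\Phi_1+\Phi_2;\Gamma_1+\Gamma_2\vdash^{[I0]+m_1+m_2}\mathsf{if}(t,s,x.u):T$. - If $\Phi_1;\Gamma_1\vdash^{m_1}t:[\mathbb S(N)]^{\mathsf{nat}}$, $N^?\lhd N$ and $\Phi_2;\,\Gamma_2,x:N^?\vdash^{m_2}u:T$, then $\Phi_1+\Phi_2;\Gamma_1+\Gamma_2\vdash^{[IS]+m_1+m_2}\mathsf{if}(t,s,x.u):T$.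 - If $\Phi,x:[T_i]_{i\in I};\,\Gamma\vdash^{m}t:S$ and $\Phi_i;\Gamma_i\vdash^{m_i}\mathsf{fix}\,x.t:T_i$ for all $i\in I$, then $\Phi+\sum_i\Phi_i;\Gamma+\sum_i\Gamma_i\vdash^{[F]+m+\sum_i m_i}\mathsf{fix}\,x.t:S$. A derivation of $\Phi;\Gamma\vdash^m t:T$ is *tight* if $\Phi=\emptyset$, $\Gamma=\emptyset$ and $T=[\,]^\nu$ for some proper nature $\nu$. **Theorem.** Let $t$ be a closed term, $\nu$ a proper nature and $m$ a multi-counter. The following are equivalent: 1. There is a tight derivation of $\emptyset;\emptyset\vdash^{m}t:[\,]^\nu$. 2. There is a sequence of steps $t=t_0\to_{\rho_1}t_1\cdots\to_{\rho_n}t_n$ with $n\ge 0$, $t_n\in \mathrm{NF}_\nu$ and $m=[\rho_1,\dots,\rho_n]$ as multisets. -/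

import Mathlib

namespace PCFH

/- ## Terms -/

/-- Terms up to renaming of bound variables, in well-scoped de Bruijn form: `Term n` is the set of
terms whose free variables are among `n` given ones (index `0` is the innermost binder).
Closed terms are the elements of `Term 0`. -/
inductive Term : ℕ → Type where
  | var {n : ℕ} (x : Fin n) : Term n
  /-- the abstraction `λ x. t` -/
  | lam {n : ℕ} (t : Term (n + 1)) : Term n
  | app {n : ℕ} (t s : Term n) : Term n
  | zero {n : ℕ} : Term n
  | succ {n : ℕ} (t : Term n) : Term n
  /-- the conditional `if(t, s, x. u)`, which binds `x` in `u` -/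
  | ifz {n : ℕ} (t s : Term n) (u : Term (n + 1)) : Term n
  /-- the fixed point `fix x. t` -/
  | fix {n : ℕ} (t : Term (n + 1)) : Term n

/-- `extend a f` assigns `a` to the innermost variable `0` and `f x` to `x + 1`. -/
def extend {α : Type} {n : ℕ} (a : α) (f : Fin n → α) : Fin (n + 1) → α :=
  fun i => Fin.cases a f i

/-- Renaming of free variables. -/
def Term.rename : {n k : ℕ} → (Fin n → Fin k) → Term n → Term k
  | _, _, r, .var x => .var (r x)
  | _, _, r, .lam t => .lam (t.rename (extend 0 (fun x => (r x).succ)))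
  | _, _, r, .app t s => .app (t.rename r) (s.rename r)
  | _, _, _, .zero => .zero
  | _, _, r, .succ t => .succ (t.rename r)
  | _, _, r, .ifz t s u =>
      .ifz (t.rename r) (s.rename r) (u.rename (extend 0 (fun x => (r x).succ)))
  | _, _, r, .fix t => .fix (t.rename (extend 0 (fun x => (r x).succ)))

/-- A substitution pushed under a binder. -/
def liftSubst {n k : ℕ} (σ : Fin n → Term k) : Fin (n + 1) → Term (k + 1) :=
  extend (Term.var 0) (fun x => (σ x).rename Fin.succ)

/-- Simultaneous capture-avoiding substitution. -/
def Term.subst : {n k : ℕ} → (Fin n → Term k) → Term n → Term k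
  | _, _, σ, .var x => σ x
  | _, _, σ, .lam t => .lam (t.subst (liftSubst σ))
  | _, _, σ, .app t s => .app (t.subst σ) (s.subst σ)
  | _, _, _, .zero => .zero
  | _, _, σ, .succ t => .succ (t.subst σ)
  | _, _, σ, .ifz t s u => .ifz (t.subst σ) (s.subst σ) (u.subst (liftSubst σ))
  | _, _, σ, .fix t => .fix (t.subst (liftSubst σ))

/-- `t{x \ s}` for the innermost free variable `x` of `t`. -/
def Term.subst1 {n : ℕ} (t : Term (n + 1)) (s : Term n) : Term n :=
  t.subst (extend s Term.var)

/-- Natural values `k ::= 0 | succ k`. -/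
inductive IsNatValue : {n : ℕ} → Term n → Prop where
  | zero {n : ℕ} : IsNatValue (Term.zero : Term n)
  | succ {n : ℕ} {k : Term n} : IsNatValue k → IsNatValue (Term.succ k)

/-- Values `v ::= λ x. t | k`. -/
inductive IsValue : {n : ℕ} → Term n → Prop where
  | lam {n : ℕ} (t : Term (n + 1)) : IsValue (Term.lam t)
  | natValue {n : ℕ} {k : Term n} : IsNatValue k → IsValue k

/- ## Operational semantics -/

/-- Rule names. -/
inductive Rule : Type where
  | B | I0 | IS | F

/-- `Step ρ t t'` is the one-step reduction `t →_ρ t'`. -/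
inductive Step : {n : ℕ} → Rule → Term n → Term n → Prop where
  | beta {n : ℕ} {t : Term (n + 1)} {v : Term n} :
      IsValue v → Step .B (.app (.lam t) v) (t.subst1 v)
  | ifZero {n : ℕ} {t : Term n} {s : Term (n + 1)} :
      Step .I0 (.ifz .zero t s) t
  | ifSucc {n : ℕ} {k t : Term n} {s : Term (n + 1)} :
      IsNatValue k → Step .IS (.ifz (.succ k) t s) (s.subst1 k)
  | fix {n : ℕ} {t : Term (n + 1)} :
      Step .F (.fix t) (t.subst1 (.fix t))
  | appL {n : ℕ} {ρ : Rule} {t t' s : Term n} :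
      Step ρ t t' → Step ρ (.app t s) (.app t' s)
  | appR {n : ℕ} {ρ : Rule} {t s s' : Term n} :
      Step ρ s s' → Step ρ (.app t s) (.app t s')
  | succ {n : ℕ} {ρ : Rule} {t t' : Term n} :
      Step ρ t t' → Step ρ (.succ t) (.succ t')
  | ifCond {n : ℕ} {ρ : Rule} {t t' s : Term n} {u : Term (n + 1)} :
      Step ρ t t' → Step ρ (.ifz t s u) (.ifz t' s u)

/-- `Steps [ρ₁, …, ρₙ] t u` : there is a sequence `t = t₀ →_ρ₁ t₁ … →_ρₙ tₙ = u`. -/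
inductive Steps {n : ℕ} : List Rule → Term n → Term n → Prop where
  | nil (t : Term n) : Steps [] t t
  | cons {ρ : Rule} {ρs : List Rule} {t t' u : Term n} :
      Step ρ t t' → Steps ρs t' u → Steps (ρ :: ρs) t u

/-- Proper natures. -/
inductive Nature : Type where
  | abs | nat

/-- Fallible natures. -/
inductive FallibleNature : Type where
  | abs | nat | stuck

/-- Every proper nature is a fallible nature. -/
def Nature.toFallible : Nature → FallibleNature
  | .abs => .abs
  | .nat => .nat

/-- `NF ε t` : the term `t` is a normal form of fallible nature `ε`. -/
inductive NF {n : ℕ} : FallibleNature → Term n → Prop where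
  | abs (t : Term (n + 1)) : NF .abs (.lam t)
  | app {ε ε' : FallibleNature} {t s : Term n} :
      NF ε t → NF ε' s → ε ≠ .abs → NF .stuck (.app t s)
  | zero : NF .nat .zero
  | succNat {t : Term n} : NF .nat t → NF .nat (.succ t)
  | succStuck {ε : FallibleNature} {t : Term n} : NF ε t → ε ≠ .nat → NF .stuck (.succ t)
  | ifz {ε : FallibleNature} {t s : Term n} {u : Term (n + 1)} :
      NF ε t → ε ≠ .nat → NF .stuck (.ifz t s u)

/- ## Types

Types are finite trees in which the components of a multitype are unordered, at every depth.
They are obtained from the trees `Pre k`, which represent multisets by lists, by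
identifying trees that differ by swaps of adjacent list entries at any depth. The types of the
system are `AbsTy`, `NatTy`, `Multitype` (multisets of the former) and `Option Multitype`, with the
constructors `AbsTy.arr`, `NatTy.zero`, `NatTy.succ`. -/

/-- The syntactic categories of types. -/
inductive Kind : Type where
  | absTy | natTy | absMul | natMul | mul | opt

/-- Raw types of each syntactic category, with lists in place of multisets. -/
inductive Pre : Kind → Type where
  | arr : Pre .opt → Pre .mul → Pre .absTy
  | zero : Pre .natTy
  | succ : Pre .natMul → Pre .natTy
  | nilA : Pre .absMul
  | consA : Pre .absTy → Pre .absMul → Pre .absMul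
  | nilN : Pre .natMul
  | consN : Pre .natTy → Pre .natMul → Pre .natMul
  | ofA : Pre .absMul → Pre .mul
  | ofN : Pre .natMul → Pre .mul
  | bot : Pre .opt
  | some : Pre .mul → Pre .opt

/-- `Swap p q` : the raw type `q` results from `p` by one swap of adjacent list entries somewhere
inside `p`. -/
inductive Swap : {k : Kind} → Pre k → Pre k → Prop where
  | swapA (a b : Pre .absTy) (l : Pre .absMul) : Swap (.consA a (.consA b l)) (.consA b (.consA a l))
  | swapN (a b : Pre .natTy) (l : Pre .natMul) : Swap (.consN a (.consN b l)) (.consN b (.consN a l))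
  | arrL {p p' : Pre .opt} (q : Pre .mul) : Swap p p' → Swap (.arr p q) (.arr p' q)
  | arrR (p : Pre .opt) {q q' : Pre .mul} : Swap q q' → Swap (.arr p q) (.arr p q')
  | succ {p p' : Pre .natMul} : Swap p p' → Swap (.succ p) (.succ p')
  | headA {a a' : Pre .absTy} (l : Pre .absMul) : Swap a a' → Swap (.consA a l) (.consA a' l)
  | tailA (a : Pre .absTy) {l l' : Pre .absMul} : Swap l l' → Swap (.consA a l) (.consA a l')
  | headN {a a' : Pre .natTy} (l : Pre .natMul) : Swap a a' → Swap (.consN a l) (.consN a' l)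
  | tailN (a : Pre .natTy) {l l' : Pre .natMul} : Swap l l' → Swap (.consN a l) (.consN a l')
  | ofA {p p' : Pre .absMul} : Swap p p' → Swap (.ofA p) (.ofA p')
  | ofN {p p' : Pre .natMul} : Swap p p' → Swap (.ofN p) (.ofN p')
  | some {p p' : Pre .mul} : Swap p p' → Swap (.some p) (.some p')

/-- Raw types of one category up to reordering at all depths. -/
def Cls (k : Kind) : Type := Quot (@Swap k)

/-- `abs`-types. -/
abbrev AbsTy : Type := Cls .absTy

/-- `nat`-types. -/
abbrev NatTy : Type := Cls .natTy

/-- Multitypes: a multiset of `abs`-types decorated with `abs`, or a multiset of `nat`-types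
decorated with `nat`. -/
inductive Multitype : Type where
  | abs (A : Multiset AbsTy) : Multitype
  | nat (N : Multiset NatTy) : Multitype

def Cls.consA : AbsTy → Cls .absMul → Cls .absMul :=
  Quot.map₂ Pre.consA (fun a _ _ h => Swap.tailA a h) (fun _ _ l h => Swap.headA l h)

def Cls.consN : NatTy → Cls .natMul → Cls .natMul :=
  Quot.map₂ Pre.consN (fun a _ _ h => Swap.tailN a h) (fun _ _ l h => Swap.headN l h)

instance : LeftCommutative Cls.consA where
  left_comm := by
    rintro ⟨a⟩ ⟨b⟩ ⟨l⟩
    exact Quot.sound (Swap.swapA a b l)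

instance : LeftCommutative Cls.consN where
  left_comm := by
    rintro ⟨a⟩ ⟨b⟩ ⟨l⟩
    exact Quot.sound (Swap.swapN a b l)

/-- The class of raw lists that represent a given multiset of `abs`-types. -/
def Cls.ofAbsMultiset (A : Multiset AbsTy) : Cls .absMul :=
  A.foldr Cls.consA (Quot.mk _ Pre.nilA)

/-- The class of raw lists that represent a given multiset of `nat`-types. -/
def Cls.ofNatMultiset (N : Multiset NatTy) : Cls .natMul :=
  N.foldr Cls.consN (Quot.mk _ Pre.nilN)

def Cls.ofMultitype : Multitype → Cls .mul
  | .abs A => Quot.map Pre.ofA (fun _ _ h => Swap.ofA h) (Cls.ofAbsMultiset A)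
  | .nat N => Quot.map Pre.ofN (fun _ _ h => Swap.ofN h) (Cls.ofNatMultiset N)

def Cls.ofOption : Option Multitype → Cls .opt
  | none => Quot.mk _ Pre.bot
  | some T => Quot.map Pre.some (fun _ _ h => Swap.some h) (Cls.ofMultitype T)

/-- The `abs`-type `T? → S`. Optional multitypes are elements of `Option Multitype`, with
`none` for `⊥`. -/
def AbsTy.arr (o : Option Multitype) (S : Multitype) : AbsTy :=
  Quot.map₂ Pre.arr (fun p _ _ h => Swap.arrR p h) (fun _ _ q h => Swap.arrL q h)
    (Cls.ofOption o) (Cls.ofMultitype S)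

/-- The `nat`-type `0`. -/
def NatTy.zero : NatTy := Quot.mk _ Pre.zero

/-- The `nat`-type `S(N)` for a `nat`-multitype `N`. -/
def NatTy.succ (N : Multiset NatTy) : NatTy :=
  Quot.map Pre.succ (fun _ _ h => Swap.succ h) (Cls.ofNatMultiset N)

/- The type constructors are injective, disjoint and exhaustive. -/

/-- What one sees of a raw type when only its topmost constructors are unfolded. -/
def View : Kind → Type
  | .absTy => Option Multitype × Multitype
  | .natTy => Option (Multiset NatTy)
  | .absMul => Multiset AbsTy
  | .natMul => Multiset NatTy
  | .mul => Multitype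
  | .opt => Option Multitype

def Pre.view : {k : Kind} → Pre k → View k
  | _, .arr p q => (p.view, q.view)
  | _, .zero => (none : Option (Multiset NatTy))
  | _, .succ p => Option.some (p.view : Multiset NatTy)
  | _, .nilA => (0 : Multiset AbsTy)
  | _, .consA a l => ((Quot.mk _ a : AbsTy) ::ₘ (l.view : Multiset AbsTy))
  | _, .nilN => (0 : Multiset NatTy)
  | _, .consN a l => ((Quot.mk _ a : NatTy) ::ₘ (l.view : Multiset NatTy))
  | _, .ofA p => Multitype.abs p.view
  | _, .ofN p => Multitype.nat p.view
  | _, .bot => (none : Option Multitype)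
  | _, .some p => Option.some (p.view : Multitype)

theorem Swap.view_eq {k : Kind} {p q : Pre k} (h : Swap p q) : p.view = q.view := by
  induction h with
  | swapA a b l => exact Multiset.cons_swap _ _ _
  | swapN a b l => exact Multiset.cons_swap _ _ _
  | arrL q _ ih => exact congrArg (fun z => (z, q.view)) ih
  | arrR p _ ih => exact congrArg (fun z => (p.view, z)) ih
  | succ _ ih => exact congrArg (fun z : Multiset NatTy => Option.some z) ih
  | headA l h _ =>
      exact congrArg (fun z : AbsTy => z ::ₘ (l.view : Multiset AbsTy)) (Quot.sound h)
  | tailA a _ ih => exact congrArg (fun z : Multiset AbsTy => (Quot.mk _ a : AbsTy) ::ₘ z) ih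
  | headN l h _ =>
      exact congrArg (fun z : NatTy => z ::ₘ (l.view : Multiset NatTy)) (Quot.sound h)
  | tailN a _ ih => exact congrArg (fun z : Multiset NatTy => (Quot.mk _ a : NatTy) ::ₘ z) ih
  | ofA _ ih => exact congrArg Multitype.abs ih
  | ofN _ ih => exact congrArg Multitype.nat ih
  | some _ ih => exact congrArg (fun z : Multitype => Option.some z) ih

def Cls.view {k : Kind} : Cls k → View k :=
  Quot.lift Pre.view (fun _ _ h => h.view_eq)

theorem Cls.view_ofAbsMultiset (A : Multiset AbsTy) : (Cls.ofAbsMultiset A).view = A := by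
  induction A using Multiset.induction with
  | empty => rfl
  | cons a A ih =>
      have h : Cls.ofAbsMultiset (a ::ₘ A) = Cls.consA a (Cls.ofAbsMultiset A) :=
        Multiset.foldr_cons _ _ _ _
      rw [h]
      generalize Cls.ofAbsMultiset A = c at ih
      subst ih
      obtain ⟨a⟩ := a
      obtain ⟨c⟩ := c
      rfl

theorem Cls.view_ofNatMultiset (N : Multiset NatTy) : (Cls.ofNatMultiset N).view = N := by
  induction N using Multiset.induction with
  | empty => rfl
  | cons a N ih =>
      have h : Cls.ofNatMultiset (a ::ₘ N) = Cls.consN a (Cls.ofNatMultiset N) :=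
        Multiset.foldr_cons _ _ _ _
      rw [h]
      generalize Cls.ofNatMultiset N = c at ih
      subst ih
      obtain ⟨a⟩ := a
      obtain ⟨c⟩ := c
      rfl

theorem Cls.view_ofMultitype (T : Multitype) : (Cls.ofMultitype T).view = T := by
  cases T with
  | abs A =>
      have h := Cls.view_ofAbsMultiset A
      change Cls.view (Quot.map Pre.ofA (fun _ _ h => Swap.ofA h) (Cls.ofAbsMultiset A)) = _
      generalize Cls.ofAbsMultiset A = c at h ⊢
      subst h
      obtain ⟨c⟩ := c
      rfl
  | nat N =>
      have h := Cls.view_ofNatMultiset N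
      change Cls.view (Quot.map Pre.ofN (fun _ _ h => Swap.ofN h) (Cls.ofNatMultiset N)) = _
      generalize Cls.ofNatMultiset N = c at h ⊢
      subst h
      obtain ⟨c⟩ := c
      rfl

theorem Cls.view_ofOption (o : Option Multitype) : (Cls.ofOption o).view = o := by
  cases o with
  | none => rfl
  | some T =>
      have h := Cls.view_ofMultitype T
      change Cls.view (Quot.map Pre.some (fun _ _ h => Swap.some h) (Cls.ofMultitype T)) = _
      generalize Cls.ofMultitype T = c at h ⊢
      subst h
      obtain ⟨c⟩ := c
      rfl

theorem AbsTy.view_arr (o : Option Multitype) (S : Multitype) :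
    (AbsTy.arr o S).view = (o, S) := by
  have h1 := Cls.view_ofOption o
  have h2 := Cls.view_ofMultitype S
  unfold AbsTy.arr
  generalize Cls.ofOption o = c at h1 ⊢
  generalize Cls.ofMultitype S = d at h2 ⊢
  subst h1
  subst h2
  obtain ⟨c⟩ := c
  obtain ⟨d⟩ := d
  rfl

theorem NatTy.view_succ (N : Multiset NatTy) : (NatTy.succ N).view = some N := by
  have h := Cls.view_ofNatMultiset N
  unfold NatTy.succ
  generalize Cls.ofNatMultiset N = c at h ⊢
  subst h
  obtain ⟨c⟩ := c
  rfl

theorem AbsTy.arr_inj {o o' : Option Multitype} {S S' : Multitype} :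
    AbsTy.arr o S = AbsTy.arr o' S' ↔ o = o' ∧ S = S' := by
  constructor
  · intro h
    have h' := congrArg Cls.view h
    rw [AbsTy.view_arr, AbsTy.view_arr] at h'
    exact Prod.mk.inj h'
  · rintro ⟨rfl, rfl⟩
    rfl

theorem NatTy.succ_inj {N N' : Multiset NatTy} : NatTy.succ N = NatTy.succ N' ↔ N = N' := by
  constructor
  · intro h
    have h' := congrArg Cls.view h
    rw [NatTy.view_succ, NatTy.view_succ] at h'
    exact Option.some.inj h'
  · rintro rfl
    rfl

theorem NatTy.zero_ne_succ (N : Multiset NatTy) : NatTy.zero ≠ NatTy.succ N := by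
  intro h
  have h' := congrArg Cls.view h
  rw [NatTy.view_succ] at h'
  have h0 : NatTy.zero.view = (none : Option (Multiset NatTy)) := rfl
  exact Option.some_ne_none N (h'.symm.trans h0)

/-- The class of raw types with a given view. -/
def View.reify : {k : Kind} → View k → Cls k
  | .absTy, v => AbsTy.arr v.1 v.2
  | .natTy, v => Option.elim v NatTy.zero NatTy.succ
  | .absMul, v => Cls.ofAbsMultiset v
  | .natMul, v => Cls.ofNatMultiset v
  | .mul, v => Cls.ofMultitype v
  | .opt, v => Cls.ofOption v

theorem Pre.reify_view {k : Kind} (p : Pre k) : View.reify p.view = Quot.mk _ p := by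
  induction p with
  | arr p q ihp ihq =>
      change Quot.map₂ Pre.arr (fun p _ _ h => Swap.arrR p h) (fun _ _ q h => Swap.arrL q h)
        (View.reify p.view) (View.reify q.view) = _
      rw [ihp, ihq]
      rfl
  | zero => rfl
  | succ p ih =>
      change Quot.map Pre.succ (fun _ _ h => Swap.succ h) (View.reify p.view) = _
      rw [ih]
      rfl
  | nilA => rfl
  | consA a l _ ih =>
      refine (Multiset.foldr_cons Cls.consA _ _ _).trans ?_
      change Cls.consA _ (View.reify l.view) = _
      rw [ih]
      rfl
  | nilN => rfl
  | consN a l _ ih =>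
      refine (Multiset.foldr_cons Cls.consN _ _ _).trans ?_
      change Cls.consN _ (View.reify l.view) = _
      rw [ih]
      rfl
  | ofA p ih =>
      change Quot.map Pre.ofA (fun _ _ h => Swap.ofA h) (View.reify p.view) = _
      rw [ih]
      rfl
  | ofN p ih =>
      change Quot.map Pre.ofN (fun _ _ h => Swap.ofN h) (View.reify p.view) = _
      rw [ih]
      rfl
  | bot => rfl
  | some p ih =>
      change Quot.map Pre.some (fun _ _ h => Swap.some h) (View.reify p.view) = _
      rw [ih]
      rfl

theorem AbsTy.exists_eq_arr (τ : AbsTy) : ∃ o S, τ = AbsTy.arr o S := by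
  obtain ⟨p⟩ := τ
  exact ⟨p.view.1, p.view.2, p.reify_view.symm⟩

theorem NatTy.eq_zero_or_succ (τ : NatTy) : τ = NatTy.zero ∨ ∃ N, τ = NatTy.succ N := by
  obtain ⟨p⟩ := τ
  cases p with
  | zero => exact Or.inl rfl
  | succ p => exact Or.inr ⟨p.view, (Pre.succ p).reify_view.symm⟩

/- ## Multitypes, sums and contexts -/

/-- The empty `ν`-multitype. -/
def Multitype.empty : Nature → Multitype
  | .abs => .abs 0
  | .nat => .nat 0

/-- The nature of a multitype. -/
def Multitype.nature : Multitype → Nature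
  | .abs _ => .abs
  | .nat _ => .nat

/-- Compatibility of optional multitypes: one of them is `⊥` or both are multitypes of the same
nature. -/
def Compatible : Option Multitype → Option Multitype → Prop
  | some T, some S => T.nature = S.nature
  | _, _ => True

/-- The sum of compatible optional multitypes. (The sum of incompatible ones is meaningless and is
never used.) -/
def optAdd : Option Multitype → Option Multitype → Option Multitype
  | none, o => o
  | some T, none => some T
  | some (.abs A), some (.abs B) => some (.abs (A + B))
  | some (.nat N), some (.nat M) => some (.nat (N + M))
  | some (.abs A), some (.nat _) => some (.abs A)
  | some (.nat N), some (.abs _) => some (.nat N)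

/-- Family contexts assign a multitype family, that is, a multiset of multitypes, to each of the `n`
free variables. They are added pointwise. -/
abbrev FamCtx (n : ℕ) : Type := Fin n → Multiset Multitype

/-- Typing contexts assign an optional multitype to each of the `n` free variables. -/
abbrev TypCtx (n : ℕ) : Type := Fin n → Option Multitype

/-- The empty family context. -/
def FamCtx.empty {n : ℕ} : FamCtx n := fun _ => 0

/-- The empty typing context. -/
def TypCtx.empty {n : ℕ} : TypCtx n := fun _ => none

/-- The family context that consists of `x : ⟦T⟧` only. -/
def FamCtx.single {n : ℕ} (x : Fin n) (T : Multitype) : FamCtx n :=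
  fun y => if y = x then {T} else 0

/-- The typing context that consists of `x : T` only. -/
def TypCtx.single {n : ℕ} (x : Fin n) (T : Multitype) : TypCtx n :=
  fun y => if y = x then some T else none

/-- Compatibility of typing contexts. -/
def TypCtx.Compat {n : ℕ} (Γ Δ : TypCtx n) : Prop := ∀ x, Compatible (Γ x) (Δ x)

/-- The sum of two compatible typing contexts. -/
def TypCtx.add {n : ℕ} (Γ Δ : TypCtx n) : TypCtx n := fun x => optAdd (Γ x) (Δ x)

/-- The sum of a finite family of pairwise compatible typing contexts. -/
def TypCtx.sum {n I : ℕ} (Γ : Fin I → TypCtx n) : TypCtx n :=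
  (List.ofFn Γ).foldr TypCtx.add TypCtx.empty

/-- Subsumption. -/
inductive Subsumes : Option Multitype → Multitype → Prop where
  | bot (ν : Nature) : Subsumes none (Multitype.empty ν)
  | refl (T : Multitype) : Subsumes (some T) T

/-- A multi-counter is a multiset of rule names. -/
abbrev MultiCounter : Type := Multiset Rule

/- ## The type system -/

/-- `Derivable Φ Γ m t T` : there is a derivation of the judgment with family context `Φ`, typing
context `Γ`, multi-counter `m`, subject `t` and type `T`.

The finite index sets of the rules are `Fin I` with `I : ℕ`. A variable bound by an abstraction or a
conditional has an empty multitype family in the premise, and one bound by a fixed point has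
the optional multitype `⊥` there, as domains of family contexts and typing contexts are
disjoint. (In a derivation whose final contexts are empty, these conditions make the domains disjoint
in every judgment.) -/
inductive Derivable : {n : ℕ} → FamCtx n → TypCtx n → MultiCounter → Term n → Multitype → Prop where
  | var₁ {n : ℕ} (x : Fin n) (T : Multitype) :
      Derivable FamCtx.empty (TypCtx.single x T) 0 (.var x) T
  | var₂ {n : ℕ} (x : Fin n) (T : Multitype) :
      Derivable (FamCtx.single x T) TypCtx.empty 0 (.var x) T
  | abs {n : ℕ} {t : Term (n + 1)} (I : ℕ) (Φ : Fin I → FamCtx n) (Γ : Fin I → TypCtx n)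
      (m : Fin I → MultiCounter) (o : Fin I → Option Multitype) (S : Fin I → Multitype) :
      (∀ i, Derivable (extend 0 (Φ i)) (extend (o i) (Γ i)) (m i) t (S i)) →
      (∀ i j, i ≠ j → (Γ i).Compat (Γ j)) →
      Derivable (∑ i, Φ i) (TypCtx.sum Γ) (∑ i, m i) (.lam t)
        (.abs (Finset.univ.val.map (fun i => AbsTy.arr (o i) (S i))))
  | app {n : ℕ} {t s : Term n} {Φ₁ Φ₂ : FamCtx n} {Γ₁ Γ₂ : TypCtx n} {m₁ m₂ : MultiCounter}
      {o : Option Multitype} {S T : Multitype} :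
      Derivable Φ₁ Γ₁ m₁ t (.abs {AbsTy.arr o S}) →
      Subsumes o T →
      Derivable Φ₂ Γ₂ m₂ s T →
      Γ₁.Compat Γ₂ →
      Derivable (Φ₁ + Φ₂) (Γ₁.add Γ₂) ({Rule.B} + m₁ + m₂) (.app t s) S
  | zero {n : ℕ} (k : ℕ) :
      Derivable (FamCtx.empty : FamCtx n) TypCtx.empty 0 .zero
        (.nat (Multiset.replicate k NatTy.zero))
  | succ {n : ℕ} {t : Term n} {Φ : FamCtx n} {Γ : TypCtx n} {m : MultiCounter}
      (I : ℕ) (N : Fin I → Multiset NatTy) :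
      Derivable Φ Γ m t (.nat (∑ i, N i)) →
      Derivable Φ Γ m (.succ t) (.nat (Finset.univ.val.map (fun i => NatTy.succ (N i))))
  | ifZero {n : ℕ} {t s : Term n} {u : Term (n + 1)} {Φ₁ Φ₂ : FamCtx n} {Γ₁ Γ₂ : TypCtx n}
      {m₁ m₂ : MultiCounter} {T : Multitype} :
      Derivable Φ₁ Γ₁ m₁ t (.nat {NatTy.zero}) →
      Derivable Φ₂ Γ₂ m₂ s T →
      Γ₁.Compat Γ₂ →
      Derivable (Φ₁ + Φ₂) (Γ₁.add Γ₂) ({Rule.I0} + m₁ + m₂) (.ifz t s u) T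
  | ifSucc {n : ℕ} {t s : Term n} {u : Term (n + 1)} {Φ₁ Φ₂ : FamCtx n} {Γ₁ Γ₂ : TypCtx n}
      {m₁ m₂ : MultiCounter} {N : Multiset NatTy} {o : Option Multitype} {T : Multitype} :
      Derivable Φ₁ Γ₁ m₁ t (.nat {NatTy.succ N}) →
      Subsumes o (.nat N) →
      Derivable (extend 0 Φ₂) (extend o Γ₂) m₂ u T →
      Γ₁.Compat Γ₂ →
      Derivable (Φ₁ + Φ₂) (Γ₁.add Γ₂) ({Rule.IS} + m₁ + m₂) (.ifz t s u) T
  | fix {n : ℕ} {t : Term (n + 1)} {Φ₀ : FamCtx n} {Γ₀ : TypCtx n} {m₀ : MultiCounter}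
      {S : Multitype} (I : ℕ) (T : Fin I → Multitype) (Φ : Fin I → FamCtx n)
      (Γ : Fin I → TypCtx n) (m : Fin I → MultiCounter) :
      Derivable (extend (Finset.univ.val.map T) Φ₀) (extend none Γ₀) m₀ t S →
      (∀ i, Derivable (Φ i) (Γ i) (m i) (.fix t) (T i)) →
      (∀ i, Γ₀.Compat (Γ i)) →
      (∀ i j, i ≠ j → (Γ i).Compat (Γ j)) →
      Derivable (Φ₀ + ∑ i, Φ i) (Γ₀.add (TypCtx.sum Γ)) ({Rule.F} + m₀ + ∑ i, m i) (.fix t) S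

/-- A multitype is tight if it is the empty multitype of some nature. -/
def Multitype.Tight (T : Multitype) : Prop := ∃ ν : Nature, T = Multitype.empty ν

/-- There is a tight derivation of the judgment: both contexts are empty and the type is tight. -/
def TightDerivable {n : ℕ} (Φ : FamCtx n) (Γ : TypCtx n) (m : MultiCounter) (t : Term n)
    (T : Multitype) : Prop :=
  Derivable Φ Γ m t T ∧ Φ = FamCtx.empty ∧ Γ = TypCtx.empty ∧ T.Tight

end PCFH

namespace PCFH

open Function (Injective)

/-! ## Finite families and multisets -/

/-! The theorem rests on an exact one-step law, `Step.closedDerivable_iff`: if a closed term `t`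
reduces to `t'` by rule `ρ`, then `t` has type `T` with counter `m` if and only if `t'` has type `T`
with a counter `m'` such that `m = [ρ] + m'`. It holds for every step, so no reduction strategy has
to be fixed. Two facts about the end of a reduction complete the argument: a typable closed term is
reducible or a value of the nature of its type (`Derivable.progress`), and a value of nature `ν` has
the type `[]^ν` with counter zero and no other (`Splittable.empty_iff`). Soundness then follows by
induction on the counter, which loses a rule name at each step, and completeness by induction on the
reduction sequence, read backwards from its normal form.

The redexes require a substitution lemma and its converse, both exact in the counter. Reduction
never enters a binder, so only closed terms are substituted. They are of two sorts. A value replaces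
a variable of the typing context; its derivations split and merge along sums of multitypes and cost
nothing at the empty multitype, so that one derivation serves any number of occurrences. An
unevaluated fixed point replaces a variable of the family context; its derivations are not merged,
and each occurrence consumes one member of the family. `Supply` axiomatizes what both have in
common, so that `Derivable.subst` and `Derivable.of_subst` are proved once for both. -/

theorem exists_eq_map_univ {α : Type} (s : Multiset α) :
    ∃ (I : ℕ) (c : Fin I → α), s = Finset.univ.val.map c := by
  induction s using Quot.ind with
  | mk l => exact ⟨l.length, l.get, by rw [Fin.univ_val_map, List.ofFn_get]; rfl⟩

/-- Premises of a rule are recorded as a multiset whose image is the type in the conclusion. A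
decomposition of the type thus lifts to the premises: the elements of `A` are peeled off one at a
time, with a preimage chosen for each. -/
theorem exists_add_of_map_eq_add {α β : Type} {f : α → β} {A B : Multiset β} {s : Multiset α}
    (h : s.map f = A + B) : ∃ s₁ s₂, s = s₁ + s₂ ∧ s₁.map f = A ∧ s₂.map f = B := by
  classical
  induction A using Multiset.induction generalizing s with
  | empty => exact ⟨0, s, by simp, by simp, by simpa using h⟩
  | cons a A ih =>
    rw [Multiset.cons_add, ← Multiset.map_eq_cons] at h
    obtain ⟨x, hx, rfl, h⟩ := h
    obtain ⟨s₁, s₂, h₁, rfl, rfl⟩ := ih h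
    exact ⟨x ::ₘ s₁, s₂, by rw [Multiset.cons_add, ← h₁, Multiset.cons_erase hx], by simp, rfl⟩

/-! ## Sums of optional multitypes and contexts -/

@[simp] theorem optAdd_none (o : Option Multitype) : optAdd o none = o := by
  cases o with
  | none => rfl
  | some T => cases T <;> rfl

theorem compatible_none (o : Option Multitype) : Compatible o none := by
  cases o <;> trivial

theorem none_compatible (o : Option Multitype) : Compatible none o := trivial

theorem Compatible.optAdd_right {o o₁ o₂ : Option Multitype} (h₁ : Compatible o o₁)
    (h₂ : Compatible o o₂) : Compatible o (optAdd o₁ o₂) := by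
  rcases o with _ | T
  · trivial
  rcases o₁ with _ | T₁
  · exact h₂
  rcases o₂ with _ | T₂
  · rwa [optAdd_none]
  -- In all cases, the default ones for incompatible summands included, `optAdd` keeps the nature of
  -- its left argument.
  cases T₁ <;> cases T₂ <;> exact h₁

/-- The sum of a finite family of optional multitypes. -/
def optSum {I : ℕ} (o : Fin I → Option Multitype) : Option Multitype :=
  (List.ofFn o).foldr optAdd none

@[simp] theorem optSum_zero (o : Fin 0 → Option Multitype) : optSum o = none := by simp [optSum]

theorem optSum_succ {I : ℕ} (o : Fin (I + 1) → Option Multitype) :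
    optSum o = optAdd (o 0) (optSum fun i => o i.succ) := by
  simp [optSum, List.ofFn_succ]

theorem TypCtx.sum_eq {n I : ℕ} (Γ : Fin I → TypCtx n) :
    TypCtx.sum Γ = fun x => optSum fun i => Γ i x := by
  funext x
  induction I with
  | zero => simp [TypCtx.sum, TypCtx.empty]
  | succ I ih =>
    rw [optSum_succ, ← ih fun i => Γ i.succ]
    simp [TypCtx.sum, List.ofFn_succ, TypCtx.add]

theorem optSum_none {I : ℕ} : optSum (fun _ : Fin I => none) = none := by
  induction I with
  | zero => simp
  | succ I ih => rw [optSum_succ, ih]; rfl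

theorem Compatible.optSum_right {I : ℕ} {o : Option Multitype} {o' : Fin I → Option Multitype}
    (h : ∀ i, Compatible o (o' i)) : Compatible o (optSum o') := by
  induction I with
  | zero => rw [optSum_zero]; exact compatible_none o
  | succ I ih => rw [optSum_succ]; exact (h 0).optAdd_right (ih fun i => h i.succ)

theorem FamCtx.sum_eq {n I : ℕ} (Φ : Fin I → FamCtx n) : (∑ i, Φ i) = fun x => ∑ i, Φ i x := by
  funext x
  exact Finset.sum_apply _ _ _

/-- Each rule concludes with contexts, counter and subject of a fixed syntactic form; this replaces
them by equal ones. -/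
theorem Derivable.cast {n : ℕ} {Φ Φ' : FamCtx n} {Γ Γ' : TypCtx n} {m m' : MultiCounter}
    {t t' : Term n} {T : Multitype} (h : Derivable Φ Γ m t T) (hΦ : Φ' = Φ) (hΓ : Γ' = Γ)
    (hm : m' = m) (ht : t' = t) : Derivable Φ' Γ' m' t' T := by
  subst hΦ hΓ hm ht
  exact h

/-! ## Renaming -/

/-- A renaming pushed under a binder. -/
abbrev liftRen {n k : ℕ} (r : Fin n → Fin k) : Fin (n + 1) → Fin (k + 1) :=
  extend 0 fun x => (r x).succ

theorem liftRen_injective {n k : ℕ} {r : Fin n → Fin k} (hr : Injective r) :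
    Injective (liftRen r) := by
  intro x y
  refine Fin.cases ?_ (fun x => ?_) x <;> refine Fin.cases ?_ (fun y => ?_) y
  · exact fun _ => rfl
  · exact fun h => absurd h.symm (Fin.succ_ne_zero (r y))
  · exact fun h => absurd h (Fin.succ_ne_zero (r x))
  · exact fun h => congrArg Fin.succ (hr (Fin.succ_injective _ h))

theorem extend_comp_liftRen {α : Type} {n k : ℕ} (a : α) (f : Fin k → α) (r : Fin n → Fin k) :
    extend a f ∘ liftRen r = extend a (f ∘ r) := by
  funext x
  refine Fin.cases rfl (fun x => rfl) x

theorem liftRen_comp {n k l : ℕ} (r : Fin n → Fin k) (r' : Fin k → Fin l) :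
    liftRen r' ∘ liftRen r = liftRen (r' ∘ r) := by
  funext x
  refine Fin.cases rfl (fun x => rfl) x

theorem liftRen_id {n : ℕ} : liftRen (id : Fin n → Fin n) = id := by
  funext x
  refine Fin.cases rfl (fun x => rfl) x

theorem Term.rename_rename {n k l : ℕ} (t : Term n) (r : Fin n → Fin k) (r' : Fin k → Fin l) :
    (t.rename r).rename r' = t.rename (r' ∘ r) := by
  induction t generalizing k l with
  | var x => rfl
  | lam t ih => simp only [Term.rename, ih, liftRen_comp]
  | app t s iht ihs => simp only [Term.rename, iht, ihs]
  | zero => rfl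
  | succ t ih => simp only [Term.rename, ih]
  | ifz t s u iht ihs ihu => simp only [Term.rename, iht, ihs, ihu, liftRen_comp]
  | fix t ih => simp only [Term.rename, ih, liftRen_comp]

theorem Term.rename_id {n : ℕ} (t : Term n) : t.rename id = t := by
  have h {n : ℕ} : (extend 0 fun x => (id x : Fin n).succ) = id := liftRen_id
  induction t with
  | var x => rfl
  | lam t ih => simp only [Term.rename, h, ih]
  | app t s iht ihs => simp only [Term.rename, iht, ihs]
  | zero => rfl
  | succ t ih => simp only [Term.rename, ih]
  | ifz t s u iht ihs ihu => simp only [Term.rename, iht, ihs, ihu, h]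
  | fix t ih => simp only [Term.rename, ih, h]

/-- Transport of an assignment along a renaming, with the value `c` outside its range. -/
noncomputable def push {α : Type} {n k : ℕ} (c : α) (r : Fin n → Fin k) (f : Fin n → α) : Fin k → α :=
  Function.extend r f fun _ => c

theorem push_apply {α : Type} {n k : ℕ} {c : α} {r : Fin n → Fin k} (hr : Injective r)
    (f : Fin n → α) (x : Fin n) : push c r f (r x) = f x := hr.extend_apply f _ x

theorem push_of_not_mem {α : Type} {n k : ℕ} {c : α} {r : Fin n → Fin k} (f : Fin n → α)
    {y : Fin k} (hy : ∀ x, r x ≠ y) : push c r f y = c :=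
  Function.extend_apply' _ _ _ fun ⟨x, h⟩ => hy x h

theorem push_cases {n k : ℕ} {r : Fin n → Fin k} {P : Fin k → Prop} (h₁ : ∀ x, P (r x))
    (h₂ : ∀ y, (∀ x, r x ≠ y) → P y) (y : Fin k) : P y := by
  by_cases h : ∃ x, r x = y
  · obtain ⟨x, rfl⟩ := h
    exact h₁ x
  · exact h₂ y fun x hx => h ⟨x, hx⟩

/-- The lifted renaming sends only `0` to `0`, and it reaches a successor exactly when `r` reaches
the predecessor. -/
theorem push_extend {α : Type} {n k : ℕ} {r : Fin n → Fin k} (hr : Injective r) (a c : α)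
    (f : Fin n → α) : push c (liftRen r) (extend a f) = extend a (push c r f) := by
  funext y
  refine Fin.cases ?_ (fun y => ?_) y
  · exact push_apply (liftRen_injective hr) (extend a f) 0
  · revert y
    refine push_cases (r := r) (fun x => ?_) (fun y hy => ?_)
    · exact (push_apply (liftRen_injective hr) (extend a f) x.succ).trans (push_apply hr f x).symm
    · refine (push_of_not_mem _ fun x => ?_).trans (push_of_not_mem f hy).symm
      refine Fin.cases ?_ (fun x => ?_) x
      · exact (Fin.succ_ne_zero y).symm
      · exact fun h => hy x (Fin.succ_injective _ h)

theorem push_const {α : Type} {n k : ℕ} {r : Fin n → Fin k} (hr : Injective r) (c : α) :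
    push c r (fun _ => c) = fun _ => c := by
  funext y
  revert y
  exact push_cases (push_apply hr _) fun y hy => push_of_not_mem _ hy

theorem push_ite {α : Type} {n k : ℕ} {r : Fin n → Fin k} (hr : Injective r) (a c : α)
    (x : Fin n) : (fun y => if y = r x then a else c) = push c r fun y => if y = x then a else c := by
  funext y
  revert y
  refine push_cases (r := r) (fun z => ?_) (fun y hy => ?_)
  · rw [push_apply hr]
    simp only [hr.eq_iff]
  · rw [push_of_not_mem _ hy, if_neg fun h => hy x h.symm]

/-- The value outside the range is neutral for the sum, which is why transport commutes with sums
here and in the next lemmas. -/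
theorem push_famAdd {n k : ℕ} {r : Fin n → Fin k} (hr : Injective r) (Φ Ψ : FamCtx n) :
    push 0 r (Φ + Ψ) = push 0 r Φ + push 0 r Ψ := by
  funext y
  revert y
  refine push_cases (r := r) (fun z => ?_) (fun y hy => ?_)
  · simp only [Pi.add_apply, push_apply hr]
  · simp only [Pi.add_apply, push_of_not_mem _ hy, add_zero]

theorem push_famSum {n k I : ℕ} {r : Fin n → Fin k} (hr : Injective r) (Φ : Fin I → FamCtx n) :
    push 0 r (∑ i, Φ i) = ∑ i, push 0 r (Φ i) := by
  funext y
  revert y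
  refine push_cases (r := r) (fun z => ?_) (fun y hy => ?_)
  · simp only [FamCtx.sum_eq, push_apply hr]
  · simp only [FamCtx.sum_eq, push_of_not_mem _ hy, Finset.sum_const_zero]

theorem push_typAdd {n k : ℕ} {r : Fin n → Fin k} (hr : Injective r) (Γ Δ : TypCtx n) :
    push none r (Γ.add Δ) = TypCtx.add (push none r Γ) (push none r Δ) := by
  funext y
  revert y
  refine push_cases (r := r) (fun z => ?_) (fun y hy => ?_)
  · simp only [TypCtx.add, push_apply hr]
  · simp only [TypCtx.add, push_of_not_mem _ hy, optAdd_none]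

theorem push_typSum {n k I : ℕ} {r : Fin n → Fin k} (hr : Injective r) (Γ : Fin I → TypCtx n) :
    push none r (TypCtx.sum Γ) = TypCtx.sum fun i => push none r (Γ i) := by
  funext y
  revert y
  refine push_cases (r := r) (fun z => ?_) (fun y hy => ?_)
  · simp only [TypCtx.sum_eq, push_apply hr]
  · simp only [TypCtx.sum_eq, push_of_not_mem _ hy, optSum_none]

theorem TypCtx.Compat.push {n k : ℕ} {r : Fin n → Fin k} (hr : Injective r) {Γ Δ : TypCtx n}
    (h : Γ.Compat Δ) : TypCtx.Compat (push none r Γ) (PCFH.push none r Δ) := by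
  refine push_cases (r := r) (fun z => ?_) (fun y hy => ?_)
  · simpa only [push_apply hr] using h z
  · simp only [push_of_not_mem _ hy]
    trivial

/-- Injectivity keeps distinct variables apart. If two were identified, their types would have to be
added, and they might be incompatible. -/
theorem Derivable.rename {n : ℕ} {Φ : FamCtx n} {Γ : TypCtx n} {m : MultiCounter} {t : Term n}
    {T : Multitype} (h : Derivable Φ Γ m t T) {k : ℕ} {r : Fin n → Fin k} (hr : Injective r) :
    Derivable (push 0 r Φ) (push none r Γ) m (t.rename r) T := by
  induction h generalizing k with
  | var₁ x T => exact (Derivable.var₁ (r x) T).cast (push_const hr 0) (push_ite hr _ _ x).symm rfl rfl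
  | var₂ x T =>
    exact (Derivable.var₂ (r x) T).cast (push_ite hr _ _ x).symm (push_const hr none) rfl rfl
  | abs I Φ Γ m o S _ hc ih =>
    refine (Derivable.abs I (fun i => push 0 r (Φ i)) (fun i => push none r (Γ i)) m o S
      (fun i => ?_) (fun i j hij => (hc i j hij).push hr)).cast
      (push_famSum hr Φ) (push_typSum hr Γ) rfl rfl
    rw [← push_extend hr, ← push_extend hr]
    exact ih i (liftRen_injective hr)
  | app _ hs _ hc ih₁ ih₂ =>
    exact (Derivable.app (ih₁ hr) hs (ih₂ hr) (hc.push hr)).cast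
      (push_famAdd hr _ _) (push_typAdd hr _ _) rfl rfl
  | zero j => exact (Derivable.zero j).cast (push_const hr 0) (push_const hr none) rfl rfl
  | succ I N _ ih => exact Derivable.succ I N (ih hr)
  | ifZero _ _ hc ih₁ ih₂ =>
    exact (Derivable.ifZero (ih₁ hr) (ih₂ hr) (hc.push hr)).cast
      (push_famAdd hr _ _) (push_typAdd hr _ _) rfl rfl
  | ifSucc _ hs _ hc ih₁ ih₂ =>
    have h₂ := ih₂ (liftRen_injective hr)
    rw [push_extend hr, push_extend hr] at h₂
    exact (Derivable.ifSucc (ih₁ hr) hs h₂ (hc.push hr)).cast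
      (push_famAdd hr _ _) (push_typAdd hr _ _) rfl rfl
  | fix I T Φ Γ m _ _ hc₀ hc ih₀ ih =>
    have h₀ := ih₀ (liftRen_injective hr)
    rw [push_extend hr, push_extend hr] at h₀
    exact (Derivable.fix I T (fun i => push 0 r (Φ i)) (fun i => push none r (Γ i)) m h₀
      (fun i => ih i hr) (fun i => (hc₀ i).push hr) (fun i j hij => (hc i j hij).push hr)).cast
      (by rw [push_famAdd hr, push_famSum hr]) (by rw [push_typAdd hr, push_typSum hr]) rfl rfl

/-- The contexts `Φ` and `Γ` are empty outside the range of `r`. -/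
def SupportedOn {n k : ℕ} (r : Fin n → Fin k) (Φ : FamCtx k) (Γ : TypCtx k) : Prop :=
  ∀ y, (∀ x, r x ≠ y) → Φ y = 0 ∧ Γ y = none

theorem SupportedOn.of_lift {n k : ℕ} {r : Fin n → Fin k} {F : Multiset Multitype}
    {o : Option Multitype} {Φ : FamCtx k} {Γ : TypCtx k}
    (h : SupportedOn (liftRen r) (extend F Φ) (extend o Γ)) : SupportedOn r Φ Γ := by
  intro y hy
  refine h y.succ fun x => ?_
  refine Fin.cases ?_ (fun x => ?_) x
  · exact (Fin.succ_ne_zero y).symm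
  · exact fun h => hy x (Fin.succ_injective _ h)

theorem SupportedOn.add {n k : ℕ} {r : Fin n → Fin k} {Φ Ψ : FamCtx k} {Γ Δ : TypCtx k}
    (h₁ : SupportedOn r Φ Γ) (h₂ : SupportedOn r Ψ Δ) : SupportedOn r (Φ + Ψ) (Γ.add Δ) := by
  intro y hy
  obtain ⟨a, b⟩ := h₁ y hy
  obtain ⟨c, d⟩ := h₂ y hy
  simp [TypCtx.add, a, b, c, d]

theorem SupportedOn.sum {n k I : ℕ} {r : Fin n → Fin k} {Φ : Fin I → FamCtx k}
    {Γ : Fin I → TypCtx k} (h : ∀ i, SupportedOn r (Φ i) (Γ i)) :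
    SupportedOn r (∑ i, Φ i) (TypCtx.sum Γ) := by
  intro y hy
  simp only [FamCtx.sum_eq, TypCtx.sum_eq, fun i => (h i y hy).1, fun i => (h i y hy).2,
    Finset.sum_const_zero, optSum_none, and_self]

theorem FamCtx.sum_comp {n k I : ℕ} (Φ : Fin I → FamCtx k) (r : Fin n → Fin k) :
    ((∑ i, Φ i : FamCtx k) ∘ r) = (∑ i, (Φ i ∘ r : FamCtx n)) := by
  simp only [FamCtx.sum_eq]
  rfl

theorem TypCtx.sum_comp {n k I : ℕ} (Γ : Fin I → TypCtx k) (r : Fin n → Fin k) :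
    TypCtx.sum Γ ∘ r = TypCtx.sum fun i => Γ i ∘ r := by
  simp only [TypCtx.sum_eq]
  rfl

theorem ite_comp_of_injective {α : Type} {n k : ℕ} {r : Fin n → Fin k} (hr : Injective r) (a c : α)
    (x : Fin n) : (fun y => if y = r x then a else c) ∘ r = fun y => if y = x then a else c := by
  funext y
  simp only [Function.comp_apply, hr.eq_iff]

/-- The contexts of a derivation mention only free variables of the subject, hence nothing outside
the range of `r`. This will show that a weakened closed term is typed in empty contexts. -/
theorem Derivable.of_rename {n : ℕ} {t : Term n} {k : ℕ} {Φ : FamCtx k} {Γ : TypCtx k}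
    {m : MultiCounter} {T : Multitype} {r : Fin n → Fin k} (hr : Injective r)
    (h : Derivable Φ Γ m (t.rename r) T) :
    SupportedOn r Φ Γ ∧ Derivable (Φ ∘ r) (Γ ∘ r) m t T := by
  induction t generalizing k Φ Γ m T with
  | var x =>
    cases h with
    | var₁ _ T =>
      exact ⟨fun y hy => ⟨rfl, if_neg fun h => hy x h.symm⟩,
        (Derivable.var₁ x T).cast rfl (ite_comp_of_injective hr _ _ x) rfl rfl⟩
    | var₂ _ T =>
      exact ⟨fun y hy => ⟨if_neg fun h => hy x h.symm, rfl⟩,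
        (Derivable.var₂ x T).cast (ite_comp_of_injective hr _ _ x) rfl rfl rfl⟩
  | lam t ih =>
    cases h with
    | abs I Φ Γ m o S h hc =>
      have h' := fun i => ih (liftRen_injective hr) (h i)
      simp only [extend_comp_liftRen] at h'
      exact ⟨SupportedOn.sum fun i => (h' i).1.of_lift,
        (Derivable.abs I (fun i => Φ i ∘ r) (fun i => Γ i ∘ r) m o S (fun i => (h' i).2)
          (fun i j hij x => hc i j hij (r x))).cast (FamCtx.sum_comp Φ r) (TypCtx.sum_comp Γ r)
          rfl rfl⟩
  | app t s iht ihs =>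
    cases h with
    | app h₁ hs h₂ hc =>
      exact ⟨(iht hr h₁).1.add (ihs hr h₂).1,
        Derivable.app (iht hr h₁).2 hs (ihs hr h₂).2 fun x => hc (r x)⟩
  | zero =>
    cases h with
    | zero j => exact ⟨fun _ _ => ⟨rfl, rfl⟩, Derivable.zero j⟩
  | succ t ih =>
    cases h with
    | succ I N h => exact ⟨(ih hr h).1, Derivable.succ I N (ih hr h).2⟩
  | ifz t s u iht ihs ihu =>
    cases h with
    | ifZero h₁ h₂ hc =>
      exact ⟨(iht hr h₁).1.add (ihs hr h₂).1,
        Derivable.ifZero (iht hr h₁).2 (ihs hr h₂).2 fun x => hc (r x)⟩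
    | ifSucc h₁ hs h₂ hc =>
      have h' := ihu (liftRen_injective hr) h₂
      simp only [extend_comp_liftRen] at h'
      exact ⟨(iht hr h₁).1.add h'.1.of_lift,
        Derivable.ifSucc (iht hr h₁).2 hs h'.2 fun x => hc (r x)⟩
  | fix t iht =>
    -- The rule for `fix x. t` has premises about `fix x. t` itself, out of reach of the induction
    -- on terms. An inner induction on the derivation handles them, while the body is left to the
    -- outer one.
    generalize hu : (Term.fix t).rename r = u at h
    induction h with
    | fix I T Φ Γ m h₀ h hc₀ hc _ ih =>
      cases hu
      have h' := iht (liftRen_injective hr) h₀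
      simp only [extend_comp_liftRen] at h'
      have ih' := fun i => ih i hr rfl
      exact ⟨h'.1.of_lift.add (SupportedOn.sum fun i => (ih' i).1),
        (Derivable.fix I T (fun i => Φ i ∘ r) (fun i => Γ i ∘ r) m h'.2 (fun i => (ih' i).2)
          (fun i x => hc₀ i (r x)) (fun i j hij x => hc i j hij (r x))).cast
          (by rw [← FamCtx.sum_comp]; rfl) (by rw [← TypCtx.sum_comp]; rfl) rfl rfl⟩
    | _ => cases hu

/-! ## Substitution of a closed term -/

/-- A closed term, seen as a term with `n` variables. -/
def Term.weaken (n : ℕ) (w : Term 0) : Term n := w.rename Fin.elim0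

theorem Term.weaken_rename {n k : ℕ} (w : Term 0) (r : Fin n → Fin k) :
    (w.weaken n).rename r = w.weaken k := by
  rw [Term.weaken, Term.rename_rename, Term.weaken]
  exact congrArg (fun r => Term.rename r w) (funext fun x : Fin 0 => x.elim0)

theorem Term.weaken_zero (w : Term 0) : w.weaken 0 = w := by
  have h : (Fin.elim0 : Fin 0 → Fin 0) = id := funext fun x => x.elim0
  rw [Term.weaken, h, Term.rename_id]

/-- Derivability of judgments on closed terms, whose contexts are trivial. -/
abbrev ClosedDerivable (m : MultiCounter) (t : Term 0) (T : Multitype) : Prop :=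
  Derivable FamCtx.empty TypCtx.empty m t T

theorem Derivable.closed {Φ : FamCtx 0} {Γ : TypCtx 0} {m : MultiCounter} {t : Term 0}
    {T : Multitype} (h : Derivable Φ Γ m t T) : ClosedDerivable m t T :=
  h.cast (Subsingleton.elim _ _) (Subsingleton.elim _ _) rfl rfl

theorem ClosedDerivable.weaken {m : MultiCounter} {w : Term 0} {T : Multitype}
    (h : ClosedDerivable m w T) (n : ℕ) :
    Derivable FamCtx.empty TypCtx.empty m (w.weaken n) T := by
  have hr : Injective (Fin.elim0 : Fin 0 → Fin n) := fun x => x.elim0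
  exact (Derivable.rename h hr).cast (push_const hr 0).symm (push_const hr none).symm rfl rfl

/-- The renaming involved has empty range, so `SupportedOn` forces both contexts to vanish at every
variable. -/
theorem Derivable.of_weaken {n : ℕ} {Φ : FamCtx n} {Γ : TypCtx n} {m : MultiCounter} {w : Term 0}
    {T : Multitype} (h : Derivable Φ Γ m (w.weaken n) T) :
    Φ = FamCtx.empty ∧ Γ = TypCtx.empty ∧ ClosedDerivable m w T := by
  obtain ⟨h₁, h₂⟩ := Derivable.of_rename (fun x => x.elim0) h
  exact ⟨funext fun y => (h₁ y fun x => x.elim0).1, funext fun y => (h₁ y fun x => x.elim0).2,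
    h₂.closed⟩

/-- `R F o m` says that the closed term `w` can be given all the types in `F` and in `o`, with
total counter `m`. These are the laws needed to substitute `w` for a variable. -/
structure Supply (w : Term 0)
    (R : Multiset Multitype → Option Multitype → MultiCounter → Prop) : Prop where
  nil : R 0 none 0
  eq_zero {m : MultiCounter} : R 0 none m → m = 0
  split {F₁ F₂ : Multiset Multitype} {o₁ o₂ : Option Multitype} {m : MultiCounter} :
    Compatible o₁ o₂ → R (F₁ + F₂) (optAdd o₁ o₂) m → ∃ m₁ m₂, R F₁ o₁ m₁ ∧ R F₂ o₂ m₂ ∧ m = m₁ + m₂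
  merge {F₁ F₂ : Multiset Multitype} {o₁ o₂ : Option Multitype} {m₁ m₂ : MultiCounter} :
    R F₁ o₁ m₁ → R F₂ o₂ m₂ → Compatible o₁ o₂ ∧ R (F₁ + F₂) (optAdd o₁ o₂) (m₁ + m₂)
  typ {T : Multitype} {m : MultiCounter} : R 0 (some T) m → ClosedDerivable m w T
  fam {T : Multitype} {m : MultiCounter} : R {T} none m → ClosedDerivable m w T
  of_derivable {T : Multitype} {m : MultiCounter} :
    ClosedDerivable m w T → R 0 (some T) m ∨ R {T} none m

section Supply

variable {w : Term 0} {R : Multiset Multitype → Option Multitype → MultiCounter → Prop}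

theorem Supply.split_sum (hR : Supply w R) {I : ℕ} {F : Fin I → Multiset Multitype}
    {o : Fin I → Option Multitype} {m : MultiCounter} (hc : ∀ i j, i ≠ j → Compatible (o i) (o j))
    (h : R (∑ i, F i) (optSum o) m) :
    ∃ m' : Fin I → MultiCounter, (∀ i, R (F i) (o i) (m' i)) ∧ m = ∑ i, m' i := by
  induction I generalizing m with
  | zero =>
    refine ⟨Fin.elim0, fun i => i.elim0, ?_⟩
    rw [optSum_zero] at h
    exact hR.eq_zero h
  | succ I ih =>
    rw [optSum_succ, Fin.sum_univ_succ] at h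
    obtain ⟨m₁, m₂, h₁, h₂, rfl⟩ :=
      hR.split (Compatible.optSum_right fun i => hc 0 i.succ (Fin.succ_ne_zero i).symm) h
    obtain ⟨m', h', rfl⟩ := ih (fun i j hij => hc _ _ ((Fin.succ_injective I).ne hij)) h₂
    refine ⟨Fin.cons m₁ m', fun i => ?_, by rw [Fin.sum_univ_succ]; rfl⟩
    exact Fin.cases h₁ h' i

/-- Unlike for splitting, compatibility is not assumed: `merge` provides it, because all that `w`
supplies through the typing context has one nature. -/
theorem Supply.merge_sum (hR : Supply w R) {I : ℕ} {F : Fin I → Multiset Multitype}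
    {o : Fin I → Option Multitype} {m : Fin I → MultiCounter} (h : ∀ i, R (F i) (o i) (m i)) :
    R (∑ i, F i) (optSum o) (∑ i, m i) := by
  induction I with
  | zero => rw [optSum_zero]; exact hR.nil
  | succ I ih =>
    rw [optSum_succ, Fin.sum_univ_succ, Fin.sum_univ_succ]
    exact (hR.merge (h 0) (ih fun i => h i.succ)).2

/-- The substitution `σ` replaces the variable `p` by the closed term `w` and each other variable
`ι y` by the variable `y`. -/
structure Replaces (w : Term 0) {N n : ℕ} (p : Fin N) (ι : Fin n → Fin N)
    (σ : Fin N → Term n) : Prop where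
  injective : Injective ι
  ne (y : Fin n) : ι y ≠ p
  eq_or (z : Fin N) : z = p ∨ ∃ y, z = ι y
  hole : σ p = w.weaken n
  var (y : Fin n) : σ (ι y) = Term.var y

/-- The shift that a binder imposes on `w` has no effect, since a weakened closed term is stable
under renaming. -/
theorem Replaces.lift {N n : ℕ} {p : Fin N} {ι : Fin n → Fin N} {σ : Fin N → Term n}
    (h : Replaces w p ι σ) : Replaces w p.succ (liftRen ι) (liftSubst σ) where
  injective := liftRen_injective h.injective
  ne y := by
    refine Fin.cases ?_ (fun y => ?_) y
    · exact (Fin.succ_ne_zero p).symm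
    · exact fun hy => h.ne y (Fin.succ_injective _ hy)
  eq_or z := by
    refine Fin.cases ?_ (fun z => ?_) z
    · exact Or.inr ⟨0, rfl⟩
    · rcases h.eq_or z with rfl | ⟨y, rfl⟩
      · exact Or.inl rfl
      · exact Or.inr ⟨y.succ, rfl⟩
  hole := (congrArg (Term.rename Fin.succ) h.hole).trans (Term.weaken_rename w Fin.succ)
  var y := by
    refine Fin.cases rfl (fun y => ?_) y
    exact congrArg (Term.rename Fin.succ) (h.var y)

theorem replaces_subst1 (w : Term 0) : Replaces w 0 Fin.elim0 (extend w Term.var) where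
  injective y := y.elim0
  ne y := y.elim0
  eq_or z := Or.inl (Fin.fin_one_eq_zero z)
  hole := w.weaken_zero.symm
  var y := y.elim0

theorem ite_comp_of_ne {α : Type} {n k : ℕ} {r : Fin n → Fin k} {z : Fin k} (hz : ∀ x, r x ≠ z)
    (a c : α) : (fun y => if y = z then a else c) ∘ r = fun _ => c :=
  funext fun x => if_neg (hz x)

/-- Wherever a rule adds contexts, the supply for `p` is split in the same way. At an axiom for `p`
it has become a derivation of `w`, by `typ` or `fam` according to the axiom; at every other axiom it
is the empty supply, of cost zero. -/
theorem Derivable.subst (hR : Supply w R) {N : ℕ} {Φ : FamCtx N} {Γ : TypCtx N} {m : MultiCounter}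
    {t : Term N} {T : Multitype} (h : Derivable Φ Γ m t T) {n : ℕ} {p : Fin N} {ι : Fin n → Fin N}
    {σ : Fin N → Term n} (hσ : Replaces w p ι σ) {m' : MultiCounter} (h' : R (Φ p) (Γ p) m') :
    Derivable (Φ ∘ ι) (Γ ∘ ι) (m + m') (t.subst σ) T := by
  induction h generalizing n m' with
  | var₁ x T =>
    rcases hσ.eq_or x with rfl | ⟨y, rfl⟩
    · rw [TypCtx.single, if_pos rfl] at h'
      exact ((hR.typ h').weaken n).cast rfl (ite_comp_of_ne hσ.ne _ _) (zero_add _) hσ.hole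
    · rw [TypCtx.single, if_neg (hσ.ne y).symm] at h'
      exact (Derivable.var₁ y T).cast rfl (ite_comp_of_injective hσ.injective _ _ y)
        (by rw [hR.eq_zero h', zero_add]) (hσ.var y)
  | var₂ x T =>
    rcases hσ.eq_or x with rfl | ⟨y, rfl⟩
    · rw [FamCtx.single, if_pos rfl] at h'
      exact ((hR.fam h').weaken n).cast (ite_comp_of_ne hσ.ne _ _) rfl (zero_add _) hσ.hole
    · rw [FamCtx.single, if_neg (hσ.ne y).symm] at h'
      exact (Derivable.var₂ y T).cast (ite_comp_of_injective hσ.injective _ _ y) rfl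
        (by rw [hR.eq_zero h', zero_add]) (hσ.var y)
  | abs I Φ Γ m o S _ hc ih =>
    rw [FamCtx.sum_eq, TypCtx.sum_eq] at h'
    obtain ⟨k, hk, rfl⟩ := hR.split_sum (fun i j hij => hc i j hij p) h'
    refine (Derivable.abs I (fun i => Φ i ∘ ι) (fun i => Γ i ∘ ι) (fun i => m i + k i) o S
      (fun i => ?_) (fun i j hij x => hc i j hij (ι x))).cast (FamCtx.sum_comp Φ ι)
      (TypCtx.sum_comp Γ ι) Finset.sum_add_distrib.symm rfl
    rw [← extend_comp_liftRen, ← extend_comp_liftRen]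
    exact ih i hσ.lift (hk i)
  | app _ hs _ hc ih₁ ih₂ =>
    obtain ⟨m₁, m₂, h₁, h₂, rfl⟩ := hR.split (hc p) h'
    exact (Derivable.app (ih₁ hσ h₁) hs (ih₂ hσ h₂) fun x => hc (ι x)).cast rfl rfl
      (by abel) rfl
  | zero j => exact (Derivable.zero j).cast rfl rfl (by rw [hR.eq_zero h', zero_add]) rfl
  | succ I N _ ih => exact Derivable.succ I N (ih hσ h')
  | ifZero _ _ hc ih₁ ih₂ =>
    obtain ⟨m₁, m₂, h₁, h₂, rfl⟩ := hR.split (hc p) h'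
    exact (Derivable.ifZero (ih₁ hσ h₁) (ih₂ hσ h₂) fun x => hc (ι x)).cast rfl rfl (by abel) rfl
  | ifSucc _ hs _ hc ih₁ ih₂ =>
    obtain ⟨m₁, m₂, h₁, h₂, rfl⟩ := hR.split (hc p) h'
    have h₂' := ih₂ hσ.lift h₂
    rw [extend_comp_liftRen, extend_comp_liftRen] at h₂'
    exact (Derivable.ifSucc (ih₁ hσ h₁) hs h₂' fun x => hc (ι x)).cast rfl rfl (by abel) rfl
  | fix I T Φ Γ m _ _ hc₀ hc ih₀ ih =>
    rw [FamCtx.sum_eq, TypCtx.sum_eq] at h'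
    obtain ⟨m₁, m₂, h₁, h₂, rfl⟩ := hR.split (Compatible.optSum_right fun i => hc₀ i p) h'
    obtain ⟨k, hk, rfl⟩ := hR.split_sum (fun i j hij => hc i j hij p) h₂
    have h₀ := ih₀ hσ.lift h₁
    rw [extend_comp_liftRen, extend_comp_liftRen] at h₀
    exact (Derivable.fix I T (fun i => Φ i ∘ ι) (fun i => Γ i ∘ ι) (fun i => m i + k i) h₀
      (fun i => ih i hσ (hk i)) (fun i x => hc₀ i (ι x)) (fun i j hij x => hc i j hij (ι x))).cast
      (by rw [← FamCtx.sum_comp]; rfl) (by rw [← TypCtx.sum_comp]; rfl)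
      (by rw [Finset.sum_add_distrib]; abel) rfl

/-- `D` holds for contexts that extend `Φ` and `Γ` to the variable `p` and for a counter that falls
short of `m` by what `w` needs to supply the types of `p`. -/
def Expands (R : Multiset Multitype → Option Multitype → MultiCounter → Prop) {N n : ℕ} (p : Fin N)
    (ι : Fin n → Fin N) (Φ : FamCtx n) (Γ : TypCtx n) (m : MultiCounter)
    (D : FamCtx N → TypCtx N → MultiCounter → Prop) : Prop :=
  ∃ Φ' Γ' m₁ m₂, D Φ' Γ' m₁ ∧ R (Φ' p) (Γ' p) m₂ ∧ m = m₁ + m₂ ∧ Φ = Φ' ∘ ι ∧ Γ = Γ' ∘ ι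

/-- The bound variable `0` lies in the range of the lifted renaming, so the entries of the expanded
contexts at `0` are already determined by `F` and `o`. -/
theorem Expands.of_lift {N n : ℕ} {p : Fin N} {ι : Fin n → Fin N} {Φ : FamCtx n} {Γ : TypCtx n}
    {F : Multiset Multitype} {o : Option Multitype} {m : MultiCounter}
    {D : FamCtx (N + 1) → TypCtx (N + 1) → MultiCounter → Prop}
    (h : Expands R p.succ (liftRen ι) (extend F Φ) (extend o Γ) m D) :
    Expands R p ι Φ Γ m fun Φ' Γ' m' => D (extend F Φ') (extend o Γ') m' := by
  obtain ⟨Φ', Γ', m₁, m₂, hD, hr, rfl, hΦ, hΓ⟩ := h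
  refine ⟨Φ' ∘ Fin.succ, Γ' ∘ Fin.succ, m₁, m₂, ?_, hr, rfl, funext fun x => congrFun hΦ x.succ,
    funext fun x => congrFun hΓ x.succ⟩
  have h₁ : extend F (Φ' ∘ Fin.succ) = Φ' :=
    funext fun x => Fin.cases (congrFun hΦ 0) (fun _ => rfl) x
  have h₂ : extend o (Γ' ∘ Fin.succ) = Γ' :=
    funext fun x => Fin.cases (congrFun hΓ 0) (fun _ => rfl) x
  show D (extend F (Φ' ∘ Fin.succ)) (extend o (Γ' ∘ Fin.succ)) m₁
  rwa [h₁, h₂]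

theorem Replaces.compat {N n : ℕ} {p : Fin N} {ι : Fin n → Fin N} {σ : Fin N → Term n}
    (hσ : Replaces w p ι σ) {Γ Δ : TypCtx N} (hp : Compatible (Γ p) (Δ p))
    (h : TypCtx.Compat (Γ ∘ ι) (Δ ∘ ι)) : Γ.Compat Δ := by
  intro z
  rcases hσ.eq_or z with rfl | ⟨y, rfl⟩
  · exact hp
  · exact h y

/-- The supplies found in the premises are merged. Merging also yields compatibility at `p`, which
the side conditions of the rules demand for the term before substitution and which the given
derivation does not mention. -/
theorem Derivable.of_subst (hR : Supply w R) {N : ℕ} {t : Term N} {n : ℕ} {p : Fin N}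
    {ι : Fin n → Fin N} {σ : Fin N → Term n} (hσ : Replaces w p ι σ) {Φ : FamCtx n} {Γ : TypCtx n}
    {m : MultiCounter} {T : Multitype} (h : Derivable Φ Γ m (t.subst σ) T) :
    Expands R p ι Φ Γ m fun Φ' Γ' m' => Derivable Φ' Γ' m' t T := by
  induction t generalizing n Φ Γ m T with
  | var x =>
    rcases hσ.eq_or x with rfl | ⟨y, rfl⟩
    · have h := (congrArg (fun s => Derivable Φ Γ m s T) hσ.hole).mp h
      obtain ⟨rfl, rfl, hw⟩ := h.of_weaken
      -- The kind of supply decides which of the two axioms types the occurrence of `p`.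
      rcases hR.of_derivable hw with h | h
      · refine ⟨_, _, _, m, Derivable.var₁ x T, ?_, (zero_add _).symm, rfl,
          (ite_comp_of_ne hσ.ne _ _).symm⟩
        rwa [TypCtx.single, if_pos rfl]
      · refine ⟨_, _, _, m, Derivable.var₂ x T, ?_, (zero_add _).symm,
          (ite_comp_of_ne hσ.ne _ _).symm, rfl⟩
        rwa [FamCtx.single, if_pos rfl]
    · have h := (congrArg (fun s => Derivable Φ Γ m s T) (hσ.var y)).mp h
      cases h with
      | var₁ =>
        refine ⟨_, _, _, 0, Derivable.var₁ (ι y) T, ?_, (zero_add _).symm, rfl,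
          (ite_comp_of_injective hσ.injective _ _ y).symm⟩
        rw [TypCtx.single, if_neg (hσ.ne y).symm]
        exact hR.nil
      | var₂ =>
        refine ⟨_, _, _, 0, Derivable.var₂ (ι y) T, ?_, (zero_add _).symm,
          (ite_comp_of_injective hσ.injective _ _ y).symm, rfl⟩
        rw [FamCtx.single, if_neg (hσ.ne y).symm]
        exact hR.nil
  | lam t ih =>
    cases h with
    | abs I Φ Γ m o S h hc =>
      choose Φ' Γ' m₁ m₂ h' hr hm hΦ hΓ using fun i => (ih hσ.lift (h i)).of_lift
      obtain rfl : Φ = fun i => Φ' i ∘ ι := funext hΦ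
      obtain rfl : Γ = fun i => Γ' i ∘ ι := funext hΓ
      obtain rfl : m = fun i => m₁ i + m₂ i := funext hm
      refine ⟨_, _, _, ∑ i, m₂ i, Derivable.abs I Φ' Γ' m₁ o S h' fun i j hij => hσ.compat
        (hR.merge (hr i) (hr j)).1 (hc i j hij), ?_, Finset.sum_add_distrib,
        (FamCtx.sum_comp Φ' ι).symm, (TypCtx.sum_comp Γ' ι).symm⟩
      rw [FamCtx.sum_eq, TypCtx.sum_eq]
      exact hR.merge_sum hr
  | app t s iht ihs =>
    cases h with
    | app h₁ hs h₂ hc =>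
      obtain ⟨Φ₁, Γ₁, m₁, k₁, d₁, r₁, rfl, rfl, rfl⟩ := iht hσ h₁
      obtain ⟨Φ₂, Γ₂, m₂, k₂, d₂, r₂, rfl, rfl, rfl⟩ := ihs hσ h₂
      obtain ⟨hp, hr⟩ := hR.merge r₁ r₂
      exact ⟨_, _, _, _, Derivable.app d₁ hs d₂ (hσ.compat hp hc), hr, by abel, rfl, rfl⟩
  | zero =>
    cases h with
    | zero j => exact ⟨_, _, _, 0, Derivable.zero j, hR.nil, rfl, rfl, rfl⟩
  | succ t ih =>
    cases h with
    | succ I N h =>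
      obtain ⟨Φ', Γ', m₁, m₂, h', hr, hm, hΦ, hΓ⟩ := ih hσ h
      exact ⟨Φ', Γ', m₁, m₂, Derivable.succ I N h', hr, hm, hΦ, hΓ⟩
  | ifz t s u iht ihs ihu =>
    cases h with
    | ifZero h₁ h₂ hc =>
      obtain ⟨Φ₁, Γ₁, m₁, k₁, d₁, r₁, rfl, rfl, rfl⟩ := iht hσ h₁
      obtain ⟨Φ₂, Γ₂, m₂, k₂, d₂, r₂, rfl, rfl, rfl⟩ := ihs hσ h₂
      obtain ⟨hp, hr⟩ := hR.merge r₁ r₂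
      exact ⟨_, _, _, _, Derivable.ifZero d₁ d₂ (hσ.compat hp hc), hr, by abel, rfl, rfl⟩
    | ifSucc h₁ hs h₂ hc =>
      obtain ⟨Φ₁, Γ₁, m₁, k₁, d₁, r₁, rfl, rfl, rfl⟩ := iht hσ h₁
      obtain ⟨Φ₂, Γ₂, m₂, k₂, d₂, r₂, rfl, rfl, rfl⟩ := (ihu hσ.lift h₂).of_lift
      obtain ⟨hp, hr⟩ := hR.merge r₁ r₂
      exact ⟨_, _, _, _, Derivable.ifSucc d₁ hs d₂ (hσ.compat hp hc), hr, by abel, rfl, rfl⟩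
  | fix t iht =>
    -- As for renaming, an inner induction on the derivation covers the premises about the fixed
    -- point itself.
    generalize hu : (Term.fix t).subst σ = u at h
    induction h with
    | fix I T Φ Γ m h₀ h hc₀ hc _ ih =>
      cases hu
      obtain ⟨Φ₀, Γ₀, m₀, k₀, d₀, r₀, rfl, rfl, rfl⟩ := (iht hσ.lift h₀).of_lift
      choose Φ' Γ' m₁ m₂ h' hr hm hΦ hΓ using fun i => ih i hσ rfl
      obtain rfl : Φ = fun i => Φ' i ∘ ι := funext hΦ
      obtain rfl : Γ = fun i => Γ' i ∘ ι := funext hΓ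
      obtain rfl : m = fun i => m₁ i + m₂ i := funext hm
      refine ⟨_, _, _, k₀ + ∑ i, m₂ i, Derivable.fix I T Φ' Γ' m₁ d₀ h'
        (fun i => hσ.compat (hR.merge r₀ (hr i)).1 (hc₀ i))
        (fun i j hij => hσ.compat (hR.merge (hr i) (hr j)).1 (hc i j hij)), ?_,
        by rw [Finset.sum_add_distrib]; abel,
        by rw [← FamCtx.sum_comp]; rfl, by rw [← TypCtx.sum_comp]; rfl⟩
      rw [FamCtx.sum_eq, TypCtx.sum_eq]
      exact (hR.merge r₀ (hR.merge_sum hr)).2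
    | _ => cases hu

end Supply

/-! ## Inversion of the rules -/

theorem derivable_zero_iff {n : ℕ} {m : MultiCounter} {T : Multitype} :
    Derivable (FamCtx.empty : FamCtx n) TypCtx.empty m .zero T ↔
      m = 0 ∧ ∃ k, T = .nat (Multiset.replicate k NatTy.zero) := by
  constructor
  · intro h
    generalize (FamCtx.empty : FamCtx n) = Φ, (TypCtx.empty : TypCtx n) = Γ at h
    cases h with
    | zero k => exact ⟨rfl, k, rfl⟩
  · rintro ⟨rfl, k, rfl⟩
    exact Derivable.zero k

theorem derivable_succ_iff {n : ℕ} {Φ : FamCtx n} {Γ : TypCtx n} {m : MultiCounter} {t : Term n}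
    {T : Multitype} : Derivable Φ Γ m (.succ t) T ↔
      ∃ s : Multiset (Multiset NatTy), T = .nat (s.map NatTy.succ) ∧ Derivable Φ Γ m t (.nat s.sum) := by
  constructor
  · intro h
    cases h with
    | succ I N h => exact ⟨Finset.univ.val.map N, by rw [Multiset.map_map]; rfl, h⟩
  · rintro ⟨s, rfl, h⟩
    obtain ⟨I, N, rfl⟩ := exists_eq_map_univ s
    rw [Multiset.map_map]
    exact Derivable.succ I N h

/-- One multiset of triples (argument type, result type, counter) replaces the indexed families of
the rule, so that splitting a typing means splitting a multiset. The compatibility conditions are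
vacuous without variables. -/
theorem closedDerivable_lam_iff {m : MultiCounter} {t : Term 1} {T : Multitype} :
    ClosedDerivable m (.lam t) T ↔ ∃ s : Multiset (Option Multitype × Multitype × MultiCounter),
      (∀ e ∈ s, Derivable (extend 0 FamCtx.empty) (extend e.1 TypCtx.empty) e.2.2 t e.2.1) ∧
      T = .abs (s.map fun e => AbsTy.arr e.1 e.2.1) ∧ m = (s.map fun e => e.2.2).sum := by
  constructor
  · intro h
    unfold ClosedDerivable at h
    -- Case analysis on `h` must identify the contexts with the sums in the rule, which succeeds
    -- once they are variables.
    generalize (FamCtx.empty : FamCtx 0) = Φ', (TypCtx.empty : TypCtx 0) = Γ' at h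
    cases h with
    | abs I Φ Γ m o S h hc =>
      refine ⟨Finset.univ.val.map fun i => (o i, S i, m i), ?_, ?_, ?_⟩
      · simp only [Multiset.mem_map]
        rintro _ ⟨i, -, rfl⟩
        exact (h i).cast (congrArg _ (Subsingleton.elim _ _)) (congrArg _ (Subsingleton.elim _ _))
          rfl rfl
      · rw [Multiset.map_map]; rfl
      · rw [Multiset.map_map]; rfl
  · rintro ⟨s, h, rfl, rfl⟩
    obtain ⟨I, c, rfl⟩ := exists_eq_map_univ s
    rw [Multiset.map_map, Multiset.map_map]
    exact (Derivable.abs I (fun _ => FamCtx.empty) (fun _ => TypCtx.empty) (fun i => (c i).2.2)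
      (fun i => (c i).1) (fun i => (c i).2.1)
      (fun i => h (c i) (Multiset.mem_map_of_mem c (Finset.mem_univ i)))
      (fun _ _ _ x => x.elim0)).closed

theorem closedDerivable_app_iff {m : MultiCounter} {t s : Term 0} {S : Multitype} :
    ClosedDerivable m (.app t s) S ↔ ∃ o m₁ m₂, ClosedDerivable m₁ t (.abs {AbsTy.arr o S}) ∧
      (∃ T, Subsumes o T ∧ ClosedDerivable m₂ s T) ∧ m = {Rule.B} + m₁ + m₂ := by
  constructor
  · intro h
    unfold ClosedDerivable at h
    generalize (FamCtx.empty : FamCtx 0) = Φ', (TypCtx.empty : TypCtx 0) = Γ' at h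
    cases h with
    | app h₁ hs h₂ hc => exact ⟨_, _, _, h₁.closed, ⟨_, hs, h₂.closed⟩, rfl⟩
  · rintro ⟨o, m₁, m₂, h₁, ⟨T, hs, h₂⟩, rfl⟩
    exact (Derivable.app h₁ hs h₂ fun x => x.elim0).closed

theorem closedDerivable_ifz_iff {m : MultiCounter} {t s : Term 0} {u : Term 1} {T : Multitype} :
    ClosedDerivable m (.ifz t s u) T ↔
      (∃ m₁ m₂, ClosedDerivable m₁ t (.nat {NatTy.zero}) ∧ ClosedDerivable m₂ s T ∧
        m = {Rule.I0} + m₁ + m₂) ∨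
      ∃ o N m₁ m₂, ClosedDerivable m₁ t (.nat {NatTy.succ N}) ∧ Subsumes o (.nat N) ∧
        Derivable (extend 0 FamCtx.empty) (extend o TypCtx.empty) m₂ u T ∧
        m = {Rule.IS} + m₁ + m₂ := by
  constructor
  · intro h
    unfold ClosedDerivable at h
    generalize (FamCtx.empty : FamCtx 0) = Φ', (TypCtx.empty : TypCtx 0) = Γ' at h
    cases h with
    | ifZero h₁ h₂ hc => exact Or.inl ⟨_, _, h₁.closed, h₂.closed, rfl⟩
    | ifSucc h₁ hs h₂ hc =>
      exact Or.inr ⟨_, _, _, _, h₁.closed, hs, h₂.cast (congrArg _ (Subsingleton.elim _ _))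
        (congrArg _ (Subsingleton.elim _ _)) rfl rfl, rfl⟩
  · rintro (⟨m₁, m₂, h₁, h₂, rfl⟩ | ⟨o, N, m₁, m₂, h₁, hs, h₂, rfl⟩)
    · exact (Derivable.ifZero h₁ h₂ fun x => x.elim0).closed
    · exact (Derivable.ifSucc h₁ hs h₂ fun x => x.elim0).closed

/-- The closed term `w` has all the types in `F`, with total counter `m`. -/
def FamilyDerivable (w : Term 0) (F : Multiset Multitype) (m : MultiCounter) : Prop :=
  ∃ s : Multiset (Multitype × MultiCounter), (∀ e ∈ s, ClosedDerivable e.2 w e.1) ∧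
    F = s.map Prod.fst ∧ m = (s.map Prod.snd).sum

theorem closedDerivable_fix_iff {m : MultiCounter} {t : Term 1} {S : Multitype} :
    ClosedDerivable m (.fix t) S ↔ ∃ F m₁ m₂,
      Derivable (extend F FamCtx.empty) (extend none TypCtx.empty) m₁ t S ∧
      FamilyDerivable (.fix t) F m₂ ∧ m = {Rule.F} + m₁ + m₂ := by
  constructor
  · intro h
    unfold ClosedDerivable at h
    generalize (FamCtx.empty : FamCtx 0) = Φ', (TypCtx.empty : TypCtx 0) = Γ' at h
    cases h with
    | fix I T Φ Γ m h₀ h hc₀ hc =>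
      refine ⟨_, _, _, h₀.cast (congrArg _ (Subsingleton.elim _ _))
        (congrArg _ (Subsingleton.elim _ _)) rfl rfl,
        ⟨Finset.univ.val.map fun i => (T i, m i), ?_, ?_, ?_⟩, rfl⟩
      · simp only [Multiset.mem_map]
        rintro _ ⟨i, -, rfl⟩
        exact (h i).closed
      · rw [Multiset.map_map]; rfl
      · rw [Multiset.map_map]; rfl
  · rintro ⟨F, m₁, m₂, h₀, ⟨s, h, rfl, rfl⟩, rfl⟩
    obtain ⟨I, c, rfl⟩ := exists_eq_map_univ s
    rw [Multiset.map_map] at h₀ ⊢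
    exact (Derivable.fix I (fun i => (c i).1) (fun _ => FamCtx.empty) (fun _ => TypCtx.empty)
      (fun i => (c i).2) h₀ (fun i => h (c i) (Multiset.mem_map_of_mem c (Finset.mem_univ i)))
      (fun _ x => x.elim0) (fun _ _ _ x => x.elim0)).closed

/-! ## Typing of values -/

/-- `ν` is the nature of all types of `v`, and derivations of `v` can be split and merged along
sums of types. -/
structure Splittable (v : Term 0) (ν : Nature) : Prop where
  nature {m : MultiCounter} {T : Multitype} : ClosedDerivable m v T → T.nature = ν
  empty_iff {m : MultiCounter} : ClosedDerivable m v (.empty ν) ↔ m = 0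
  add_iff {T₁ T₂ T : Multitype} {m : MultiCounter} : T₁.nature = T₂.nature →
    optAdd (some T₁) (some T₂) = some T →
    (ClosedDerivable m v T ↔
      ∃ m₁ m₂, ClosedDerivable m₁ v T₁ ∧ ClosedDerivable m₂ v T₂ ∧ m = m₁ + m₂)

/-- The premises for an abstraction are independent of each other, one per element of its type, and
their counters add up; no premise means counter zero. -/
theorem splittable_lam (t : Term 1) : Splittable (.lam t) .abs where
  nature h := by
    obtain ⟨s, -, rfl, -⟩ := closedDerivable_lam_iff.mp h
    rfl
  empty_iff := by
    intro m
    rw [closedDerivable_lam_iff]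
    constructor
    · rintro ⟨s, -, hs, rfl⟩
      obtain rfl : s = 0 := Multiset.map_eq_zero.mp (Multitype.abs.inj hs).symm
      rfl
    · rintro rfl
      exact ⟨0, by simp, rfl, rfl⟩
  add_iff := by
    intro T₁ T₂ T m hν hT
    simp only [closedDerivable_lam_iff]
    constructor
    · rintro ⟨s, h, rfl, rfl⟩
      rcases T₁ with A | A <;> rcases T₂ with B | B <;> cases hν
      · obtain ⟨s₁, s₂, rfl, rfl, rfl⟩ :=
          exists_add_of_map_eq_add (Multitype.abs.inj (Option.some.inj hT)).symm
        exact ⟨_, _, ⟨s₁, fun e he => h e (Multiset.mem_add.mpr (Or.inl he)), rfl, rfl⟩,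
          ⟨s₂, fun e he => h e (Multiset.mem_add.mpr (Or.inr he)), rfl, rfl⟩,
          by rw [Multiset.map_add, Multiset.sum_add]⟩
      · cases hT
    · rintro ⟨_, _, ⟨s₁, h₁, rfl, rfl⟩, ⟨s₂, h₂, rfl, rfl⟩, rfl⟩
      refine ⟨s₁ + s₂, fun e he => (Multiset.mem_add.mp he).elim (h₁ e) (h₂ e), ?_, ?_⟩
      · rw [Multiset.map_add]
        exact (Option.some.inj hT).symm
      · rw [Multiset.map_add, Multiset.sum_add]

theorem IsNatValue.nature {n : ℕ} {k : Term n} (hk : IsNatValue k) {m : MultiCounter}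
    {T : Multitype} (h : Derivable FamCtx.empty TypCtx.empty m k T) : ∃ N, T = .nat N := by
  cases hk with
  | zero =>
    obtain ⟨-, j, rfl⟩ := derivable_zero_iff.mp h
    exact ⟨_, rfl⟩
  | succ hk =>
    obtain ⟨s, rfl, -⟩ := derivable_succ_iff.mp h
    exact ⟨_, rfl⟩

theorem IsNatValue.derivable_nil_iff {n : ℕ} {k : Term n} (hk : IsNatValue k) {m : MultiCounter} :
    Derivable FamCtx.empty TypCtx.empty m k (.nat 0) ↔ m = 0 := by
  induction hk with
  | zero =>
    rw [derivable_zero_iff]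
    exact and_iff_left ⟨0, rfl⟩
  | succ _ ih =>
    rw [derivable_succ_iff, ← ih]
    constructor
    · rintro ⟨s, hs, h⟩
      obtain rfl : s = 0 := Multiset.map_eq_zero.mp (Multitype.nat.inj hs).symm
      exact h
    · exact fun h => ⟨0, rfl, h⟩

/-- By induction on the value. A type of `succ k` is a multiset of `S(N_i)`, and `k` has the sum of
the `N_i`; splitting the multiset splits this sum. -/
theorem IsNatValue.derivable_add_iff {n : ℕ} {k : Term n} (hk : IsNatValue k) {m : MultiCounter}
    {A B : Multiset NatTy} : Derivable FamCtx.empty TypCtx.empty m k (.nat (A + B)) ↔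
      ∃ m₁ m₂, Derivable FamCtx.empty TypCtx.empty m₁ k (.nat A) ∧
        Derivable FamCtx.empty TypCtx.empty m₂ k (.nat B) ∧ m = m₁ + m₂ := by
  induction hk generalizing m A B with
  | zero =>
    simp only [derivable_zero_iff]
    constructor
    · rintro ⟨rfl, j, hj⟩
      have h := (Multiset.eq_replicate.mp (Multitype.nat.inj hj)).2
      exact ⟨0, 0, ⟨rfl, _, congrArg _ (Multiset.eq_replicate.mpr
          ⟨rfl, fun b hb => h b (Multiset.mem_add.mpr (Or.inl hb))⟩)⟩,
        ⟨rfl, _, congrArg _ (Multiset.eq_replicate.mpr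
          ⟨rfl, fun b hb => h b (Multiset.mem_add.mpr (Or.inr hb))⟩)⟩, rfl⟩
    · rintro ⟨_, _, ⟨rfl, i, hi⟩, ⟨rfl, j, hj⟩, rfl⟩
      rw [Multitype.nat.inj hi, Multitype.nat.inj hj]
      exact ⟨rfl, i + j, congrArg _ (Multiset.replicate_add i j _).symm⟩
  | succ _ ih =>
    simp only [derivable_succ_iff]
    constructor
    · rintro ⟨s, hs, h⟩
      obtain ⟨s₁, s₂, rfl, rfl, rfl⟩ := exists_add_of_map_eq_add (Multitype.nat.inj hs).symm
      rw [Multiset.sum_add, ih] at h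
      obtain ⟨m₁, m₂, h₁, h₂, rfl⟩ := h
      exact ⟨m₁, m₂, ⟨s₁, rfl, h₁⟩, ⟨s₂, rfl, h₂⟩, rfl⟩
    · rintro ⟨m₁, m₂, ⟨s₁, hs₁, h₁⟩, ⟨s₂, hs₂, h₂⟩, rfl⟩
      refine ⟨s₁ + s₂, ?_, ?_⟩
      · rw [Multiset.map_add, Multitype.nat.inj hs₁, Multitype.nat.inj hs₂]
      · rw [Multiset.sum_add, ih]
        exact ⟨m₁, m₂, h₁, h₂, rfl⟩

theorem IsNatValue.splittable {k : Term 0} (hk : IsNatValue k) : Splittable k .nat where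
  nature h := by
    obtain ⟨N, rfl⟩ := hk.nature h
    rfl
  empty_iff := hk.derivable_nil_iff
  add_iff := by
    intro T₁ T₂ T m hν hT
    constructor
    · intro h
      obtain ⟨N, rfl⟩ := hk.nature h
      rcases T₁ with A | A <;> rcases T₂ with B | B <;> cases hν
      · cases hT
      · cases hT
        exact hk.derivable_add_iff.mp h
    · rintro ⟨m₁, m₂, h₁, h₂, rfl⟩
      obtain ⟨A, rfl⟩ := hk.nature h₁
      obtain ⟨B, rfl⟩ := hk.nature h₂
      cases hT
      exact hk.derivable_add_iff.mpr ⟨m₁, m₂, h₁, h₂, rfl⟩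

theorem IsValue.splittable {v : Term 0} (hv : IsValue v) : ∃ ν, Splittable v ν := by
  cases hv with
  | lam t => exact ⟨_, splittable_lam t⟩
  | natValue hk => exact ⟨_, hk.splittable⟩

/-- The closed term `w` has the optional multitype `o`, with counter `m`. -/
def OptDerivable (w : Term 0) : Option Multitype → MultiCounter → Prop
  | none, m => m = 0
  | some T, m => ClosedDerivable m w T

/-- Subsumption costs nothing on values: the argument of a function that ignores it is typed with an
empty multitype, and its counter is then zero, as if it had not been typed. -/
theorem Splittable.optDerivable_iff {v : Term 0} {ν : Nature} (hv : Splittable v ν)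
    {o : Option Multitype} {m : MultiCounter} :
    (∃ T, Subsumes o T ∧ ClosedDerivable m v T) ↔ OptDerivable v o m := by
  constructor
  · rintro ⟨T, hs, h⟩
    cases hs with
    | bot ν' =>
      -- The rule leaves the nature of the empty multitype open, but `v` has types of one nature
      -- only.
      have hν : ν' = ν := by
        rw [← hv.nature h]
        cases ν' <;> rfl
      subst hν
      exact hv.empty_iff.mp h
    | refl => exact h
  · intro h
    cases o with
    | none => exact ⟨_, Subsumes.bot ν, hv.empty_iff.mpr h⟩
    | some T => exact ⟨T, Subsumes.refl T, h⟩

theorem Splittable.supply {v : Term 0} {ν : Nature} (hv : Splittable v ν) :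
    Supply v fun F o m => F = 0 ∧ OptDerivable v o m where
  nil := ⟨rfl, rfl⟩
  eq_zero h := h.2
  split := by
    rintro F₁ F₂ o₁ o₂ m hc ⟨hF, h⟩
    obtain ⟨rfl, rfl⟩ := add_eq_zero.mp hF
    rcases o₁ with _ | T₁
    · exact ⟨0, m, ⟨rfl, rfl⟩, ⟨rfl, h⟩, (zero_add m).symm⟩
    rcases o₂ with _ | T₂
    · rw [optAdd_none] at h
      exact ⟨m, 0, ⟨rfl, h⟩, ⟨rfl, rfl⟩, (add_zero m).symm⟩
    obtain ⟨T, hT⟩ : ∃ T, optAdd (some T₁) (some T₂) = some T := by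
      cases T₁ <;> cases T₂ <;> exact ⟨_, rfl⟩
    rw [hT] at h
    obtain ⟨m₁, m₂, h₁, h₂, rfl⟩ := (hv.add_iff hc hT).mp h
    exact ⟨m₁, m₂, ⟨rfl, h₁⟩, ⟨rfl, h₂⟩, rfl⟩
  merge := by
    rintro F₁ F₂ o₁ o₂ m₁ m₂ ⟨rfl, h₁⟩ ⟨rfl, h₂⟩
    rcases o₁ with _ | T₁
    · obtain rfl : m₁ = 0 := h₁
      exact ⟨none_compatible _, rfl, by rwa [zero_add]⟩
    rcases o₂ with _ | T₂
    · obtain rfl : m₂ = 0 := h₂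
      exact ⟨compatible_none _, rfl, by rwa [add_zero, optAdd_none]⟩
    have hν : T₁.nature = T₂.nature := (hv.nature h₁).trans (hv.nature h₂).symm
    obtain ⟨T, hT⟩ : ∃ T, optAdd (some T₁) (some T₂) = some T := by
      cases T₁ <;> cases T₂ <;> exact ⟨_, rfl⟩
    refine ⟨hν, rfl, ?_⟩
    rw [hT]
    exact (hv.add_iff hν hT).mpr ⟨m₁, m₂, h₁, h₂, rfl⟩
  typ h := h.2
  fam h := absurd h.1 (Multiset.singleton_ne_zero _)
  of_derivable h := Or.inl ⟨rfl, h⟩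

theorem optAdd_eq_none {o₁ o₂ : Option Multitype} (h : optAdd o₁ o₂ = none) :
    o₁ = none ∧ o₂ = none := by
  rcases o₁ with _ | T₁
  · exact ⟨rfl, h⟩
  rcases o₂ with _ | T₂
  · cases h
  · cases T₁ <;> cases T₂ <;> cases h

/-- Here `w` need not be a value, and its derivations need not merge into one. The laws hold because
a family is a mere collection of types, each with a derivation of its own. -/
theorem familyDerivable_supply (w : Term 0) :
    Supply w fun F o m => o = none ∧ FamilyDerivable w F m where
  nil := ⟨rfl, 0, by simp, rfl, rfl⟩
  eq_zero := by
    rintro m ⟨-, s, -, hs, rfl⟩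
    obtain rfl : s = 0 := Multiset.map_eq_zero.mp hs.symm
    rfl
  split := by
    rintro F₁ F₂ o₁ o₂ m - ⟨ho, s, h, hs, rfl⟩
    obtain ⟨rfl, rfl⟩ := optAdd_eq_none ho
    obtain ⟨s₁, s₂, rfl, rfl, rfl⟩ := exists_add_of_map_eq_add hs.symm
    exact ⟨_, _, ⟨rfl, s₁, fun e he => h e (Multiset.mem_add.mpr (Or.inl he)), rfl, rfl⟩,
      ⟨rfl, s₂, fun e he => h e (Multiset.mem_add.mpr (Or.inr he)), rfl, rfl⟩,
      by rw [Multiset.map_add, Multiset.sum_add]⟩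
  merge := by
    rintro F₁ F₂ o₁ o₂ m₁ m₂ ⟨rfl, s₁, h₁, rfl, rfl⟩ ⟨rfl, s₂, h₂, rfl, rfl⟩
    exact ⟨trivial, rfl, s₁ + s₂, fun e he => (Multiset.mem_add.mp he).elim (h₁ e) (h₂ e),
      (Multiset.map_add _ _ _).symm, by rw [Multiset.map_add, Multiset.sum_add]⟩
  typ h := by cases h.1
  fam := by
    rintro T m ⟨-, s, h, hs, rfl⟩
    obtain ⟨e, rfl, rfl⟩ := Multiset.map_eq_singleton.mp hs.symm
    rw [Multiset.map_singleton, Multiset.sum_singleton]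
    exact h e (Multiset.mem_singleton_self e)
  of_derivable {T m} h := Or.inr ⟨rfl, {(T, m)},
    fun e he => by rw [Multiset.mem_singleton.mp he]; exact h,
    by rw [Multiset.map_singleton], by rw [Multiset.map_singleton, Multiset.sum_singleton]⟩

/-! ## Reduction and expansion of subjects -/

theorem Supply.subst1_iff {w : Term 0}
    {R : Multiset Multitype → Option Multitype → MultiCounter → Prop} (hR : Supply w R)
    {t : Term 1} {m : MultiCounter} {T : Multitype} :
    ClosedDerivable m (t.subst1 w) T ↔ ∃ F o m₁ m₂,
      Derivable (extend F FamCtx.empty) (extend o TypCtx.empty) m₁ t T ∧ R F o m₂ ∧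
      m = m₁ + m₂ := by
  constructor
  · intro h
    obtain ⟨Φ, Γ, m₁, m₂, h, hr, hm, -, -⟩ := Derivable.of_subst hR (replaces_subst1 w) h
    -- A context over one variable is determined by its entry there.
    have h₀ {α : Type} (f : Fin 1 → α) (g : Fin 0 → α) : extend (f 0) g = f :=
      funext fun x => Fin.cases rfl (fun x => x.elim0) x
    exact ⟨Φ 0, Γ 0, m₁, m₂, h.cast (h₀ Φ _) (h₀ Γ _) rfl rfl, hr, hm⟩
  · rintro ⟨F, o, m₁, m₂, h, hr, rfl⟩
    exact (Derivable.subst hR h (replaces_subst1 w) hr).closed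

/-- The right-hand side is what the rules for application and for the successor branch ask of the
body and the argument, so these redexes match their contracta up to one rule name. -/
theorem IsValue.subst1_iff {v : Term 0} (hv : IsValue v) {t : Term 1} {m : MultiCounter}
    {S : Multitype} : ClosedDerivable m (t.subst1 v) S ↔ ∃ o m₁ m₂,
      Derivable (extend 0 FamCtx.empty) (extend o TypCtx.empty) m₁ t S ∧
      (∃ T, Subsumes o T ∧ ClosedDerivable m₂ v T) ∧ m = m₁ + m₂ := by
  obtain ⟨ν, hv⟩ := hv.splittable
  rw [hv.supply.subst1_iff]
  simp only [hv.optDerivable_iff]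
  constructor
  · rintro ⟨F, o, m₁, m₂, h, ⟨rfl, hr⟩, hm⟩
    exact ⟨o, m₁, m₂, h, hr, hm⟩
  · rintro ⟨o, m₁, m₂, h, hr, hm⟩
    exact ⟨0, o, m₁, m₂, h, ⟨rfl, hr⟩, hm⟩

theorem closedDerivable_lam_singleton_iff {m : MultiCounter} {t : Term 1} {o : Option Multitype}
    {S : Multitype} : ClosedDerivable m (.lam t) (.abs {AbsTy.arr o S}) ↔
      Derivable (extend 0 FamCtx.empty) (extend o TypCtx.empty) m t S := by
  rw [closedDerivable_lam_iff]
  constructor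
  · rintro ⟨s, h, hs, rfl⟩
    obtain ⟨e, rfl, he⟩ := Multiset.map_eq_singleton.mp (Multitype.abs.inj hs).symm
    obtain ⟨rfl, rfl⟩ := AbsTy.arr_inj.mp he
    rw [Multiset.map_singleton, Multiset.sum_singleton]
    exact h e (Multiset.mem_singleton_self e)
  · intro h
    refine ⟨{(o, S, m)}, fun e he => ?_, ?_, ?_⟩
    · rw [Multiset.mem_singleton.mp he]
      exact h
    · rw [Multiset.map_singleton]
    · rw [Multiset.map_singleton, Multiset.sum_singleton]

theorem closedDerivable_succ_singleton_iff {m : MultiCounter} {t : Term 0} {N : Multiset NatTy} :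
    ClosedDerivable m (.succ t) (.nat {NatTy.succ N}) ↔ ClosedDerivable m t (.nat N) := by
  rw [ClosedDerivable, derivable_succ_iff]
  constructor
  · rintro ⟨s, hs, h⟩
    obtain ⟨M, rfl, hM⟩ := Multiset.map_eq_singleton.mp (Multitype.nat.inj hs).symm
    rwa [← NatTy.succ_inj.mp hM, ← Multiset.sum_singleton M]
  · intro h
    exact ⟨{N}, by rw [Multiset.map_singleton], by rwa [Multiset.sum_singleton]⟩

/-- Weighted subject reduction and subject expansion for closed terms. -/
theorem Step.closedDerivable_iff {ρ : Rule} {t t' : Term 0} (h : Step ρ t t') {m : MultiCounter}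
    {T : Multitype} :
    ClosedDerivable m t T ↔ ∃ m', ClosedDerivable m' t' T ∧ m = {ρ} + m' := by
  induction h generalizing m T with
  | beta hv =>
    rw [closedDerivable_app_iff]
    simp only [closedDerivable_lam_singleton_iff, hv.subst1_iff]
    constructor
    · rintro ⟨o, m₁, m₂, h₁, h₂, rfl⟩
      exact ⟨_, ⟨o, m₁, m₂, h₁, h₂, rfl⟩, add_assoc _ _ _⟩
    · rintro ⟨_, ⟨o, m₁, m₂, h₁, h₂, rfl⟩, rfl⟩
      exact ⟨o, m₁, m₂, h₁, h₂, (add_assoc _ _ _).symm⟩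
  | ifZero =>
    rw [closedDerivable_ifz_iff]
    constructor
    · rintro (⟨m₁, m₂, h₁, h₂, rfl⟩ | ⟨o, N, m₁, m₂, h₁, -⟩)
      · obtain ⟨rfl, -⟩ := derivable_zero_iff.mp h₁
        exact ⟨m₂, h₂, by rw [add_zero]⟩
      -- The successor rule is excluded: all types of `0` are copies of `NatTy.zero`.
      · obtain ⟨-, k, hk⟩ := derivable_zero_iff.mp h₁
        have hN := Multiset.eq_of_mem_replicate
          (Multitype.nat.inj hk ▸ Multiset.mem_singleton_self (NatTy.succ N))
        exact absurd hN.symm (NatTy.zero_ne_succ N)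
    · rintro ⟨m', h, rfl⟩
      -- The condition needs the singleton type, that is, one copy of `NatTy.zero`.
      exact Or.inl ⟨0, m', derivable_zero_iff.mpr ⟨rfl, 1, rfl⟩, h, by rw [add_zero]⟩
  | ifSucc hk =>
    rw [closedDerivable_ifz_iff]
    simp only [closedDerivable_succ_singleton_iff, (IsValue.natValue hk).subst1_iff]
    constructor
    · rintro (⟨m₁, m₂, h₁, -⟩ | ⟨o, N, m₁, m₂, h₁, hs, h₂, rfl⟩)
      · obtain ⟨s, hs, -⟩ := derivable_succ_iff.mp h₁
        obtain ⟨M, -, hM⟩ := Multiset.map_eq_singleton.mp (Multitype.nat.inj hs).symm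
        exact absurd hM.symm (NatTy.zero_ne_succ M)
      · exact ⟨_, ⟨o, m₂, m₁, h₂, ⟨_, hs, h₁⟩, rfl⟩, by abel⟩
    · rintro ⟨_, ⟨o, m₂, m₁, h₂, ⟨T, hs, h₁⟩, rfl⟩, rfl⟩
      -- Anti-substitution gives `k` some multitype; the rule needs a `nat`-multitype, and a natural
      -- value has no other.
      obtain ⟨N, rfl⟩ := hk.nature h₁
      exact Or.inr ⟨o, N, m₁, m₂, h₁, hs, h₂, by abel⟩
  | fix =>
    rw [closedDerivable_fix_iff]
    -- The family supplied to the bound variable is the family of types that the rule requires of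
    -- the fixed point.
    simp only [(familyDerivable_supply _).subst1_iff]
    constructor
    · rintro ⟨F, m₁, m₂, h₁, h₂, rfl⟩
      exact ⟨_, ⟨F, none, m₁, m₂, h₁, ⟨rfl, h₂⟩, rfl⟩, add_assoc _ _ _⟩
    · rintro ⟨_, ⟨F, o, m₁, m₂, h₁, ⟨rfl, h₂⟩, rfl⟩, rfl⟩
      exact ⟨F, m₁, m₂, h₁, h₂, (add_assoc _ _ _).symm⟩
  | appL _ ih =>
    simp only [closedDerivable_app_iff, ih]
    constructor
    · rintro ⟨o, _, m₂, ⟨m₁, h₁, rfl⟩, h₂, rfl⟩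
      exact ⟨_, ⟨o, m₁, m₂, h₁, h₂, rfl⟩, by abel⟩
    · rintro ⟨_, ⟨o, m₁, m₂, h₁, h₂, rfl⟩, rfl⟩
      exact ⟨o, _, m₂, ⟨m₁, h₁, rfl⟩, h₂, by abel⟩
  | appR _ ih =>
    simp only [closedDerivable_app_iff, ih]
    constructor
    · rintro ⟨o, m₁, _, h₁, ⟨S, hs, m₂, h₂, rfl⟩, rfl⟩
      exact ⟨_, ⟨o, m₁, m₂, h₁, ⟨S, hs, h₂⟩, rfl⟩, by abel⟩
    · rintro ⟨_, ⟨o, m₁, m₂, h₁, ⟨S, hs, h₂⟩, rfl⟩, rfl⟩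
      exact ⟨o, m₁, _, h₁, ⟨S, hs, m₂, h₂, rfl⟩, by abel⟩
  | succ _ ih =>
    simp only [derivable_succ_iff, ih]
    constructor
    · rintro ⟨s, rfl, m', h, rfl⟩
      exact ⟨m', ⟨s, rfl, h⟩, rfl⟩
    · rintro ⟨m', ⟨s, rfl, h⟩, rfl⟩
      exact ⟨s, rfl, m', h, rfl⟩
  | ifCond _ ih =>
    simp only [closedDerivable_ifz_iff, ih]
    constructor
    · rintro (⟨_, m₂, ⟨m₁, h₁, rfl⟩, h₂, rfl⟩ | ⟨o, N, _, m₂, ⟨m₁, h₁, rfl⟩, hs, h₂, rfl⟩)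
      · exact ⟨_, Or.inl ⟨m₁, m₂, h₁, h₂, rfl⟩, by abel⟩
      · exact ⟨_, Or.inr ⟨o, N, m₁, m₂, h₁, hs, h₂, rfl⟩, by abel⟩
    · rintro ⟨_, ⟨m₁, m₂, h₁, h₂, rfl⟩ | ⟨o, N, m₁, m₂, h₁, hs, h₂, rfl⟩, rfl⟩
      · exact Or.inl ⟨_, m₂, ⟨m₁, h₁, rfl⟩, h₂, by abel⟩
      · exact Or.inr ⟨o, N, _, m₂, ⟨m₁, h₁, rfl⟩, hs, h₂, by abel⟩

/-! ## Normal forms -/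

/-- The closed values of nature `ν`. -/
def IsValueOf {n : ℕ} : Nature → Term n → Prop
  | .abs, t => ∃ u, t = .lam u
  | .nat, t => IsNatValue t

theorem IsValueOf.splittable {v : Term 0} {ν : Nature} (hv : IsValueOf ν v) : Splittable v ν := by
  cases ν with
  | abs =>
    obtain ⟨t, rfl⟩ := hv
    exact splittable_lam t
  | nat => exact IsNatValue.splittable hv

theorem IsValueOf.isValue {n : ℕ} {v : Term n} {ν : Nature} (hv : IsValueOf ν v) : IsValue v := by
  cases ν with
  | abs =>
    obtain ⟨t, rfl⟩ := hv
    exact IsValue.lam t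
  | nat => exact IsValue.natValue hv

theorem IsNatValue.nf {n : ℕ} {k : Term n} (hk : IsNatValue k) : NF .nat k := by
  induction hk with
  | zero => exact NF.zero
  | succ _ ih => exact NF.succNat ih

theorem NF.isNatValue {n : ℕ} {t : Term n} {ε : FallibleNature} (h : NF ε t) (hε : ε = .nat) :
    IsNatValue t := by
  induction h with
  | zero => exact IsNatValue.zero
  | succNat _ ih => exact IsNatValue.succ (ih rfl)
  | _ => cases hε

/-- All normal forms other than values are produced by rules of nature `stuck`. -/
theorem nf_iff_isValueOf {n : ℕ} {t : Term n} {ν : Nature} :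
    NF ν.toFallible t ↔ IsValueOf ν t := by
  cases ν with
  | abs =>
    constructor
    · intro h
      cases h with
      | abs t => exact ⟨t, rfl⟩
    · rintro ⟨u, rfl⟩
      exact NF.abs u
  | nat => exact ⟨fun h => h.isNatValue rfl, IsNatValue.nf⟩

/-- A typable closed term is reducible or a value of the nature of its type. -/
theorem Derivable.progress {n : ℕ} {Φ : FamCtx n} {Γ : TypCtx n} {m : MultiCounter} {t : Term n}
    {T : Multitype} (h : Derivable Φ Γ m t T) (hn : n = 0) :
    (∃ ρ t', Step ρ t t') ∨ IsValueOf T.nature t := by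
  -- The number of variables is an index of the derivation, so closedness travels through the
  -- induction as an equation.
  induction h with
  | var₁ x T =>
    subst hn
    exact x.elim0
  | var₂ x T =>
    subst hn
    exact x.elim0
  | abs => exact Or.inr ⟨_, rfl⟩
  | app _ _ _ _ ih₁ ih₂ =>
    rcases ih₁ hn with ⟨ρ, t', ht⟩ | ⟨u, rfl⟩
    · exact Or.inl ⟨ρ, _, Step.appL ht⟩
    · rcases ih₂ hn with ⟨ρ, s', hs⟩ | hs
      · exact Or.inl ⟨ρ, _, Step.appR hs⟩
      · exact Or.inl ⟨_, _, Step.beta hs.isValue⟩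
  | zero => exact Or.inr IsNatValue.zero
  | succ _ _ _ ih =>
    rcases ih hn with ⟨ρ, t', ht⟩ | ht
    · exact Or.inl ⟨ρ, _, Step.succ ht⟩
    · exact Or.inr (IsNatValue.succ ht)
  | ifZero _ _ _ ih _ | ifSucc _ _ _ _ ih _ =>
    rcases ih hn with ⟨ρ, t', ht⟩ | ht
    · exact Or.inl ⟨ρ, _, Step.ifCond ht⟩
    -- Only the nature of the condition's type is used: whichever natural value the condition is,
    -- one of the two branches fires.
    · have ht : IsNatValue _ := ht
      cases ht with
      | zero => exact Or.inl ⟨_, _, Step.ifZero⟩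
      | succ hk => exact Or.inl ⟨_, _, Step.ifSucc hk⟩
  | fix => exact Or.inl ⟨_, _, Step.fix⟩

/-! ### Soundness and completeness -/

theorem Multitype.nature_empty (ν : Nature) : (Multitype.empty ν).nature = ν := by
  cases ν <;> rfl

/-- Progress offers some step as long as the term is not a value. Each step removes its rule name
from the counter, so the process stops, and at the final value the counter is empty. -/
theorem ClosedDerivable.exists_steps {m : MultiCounter} {t : Term 0} {ν : Nature}
    (h : ClosedDerivable m t (.empty ν)) :
    ∃ (ρs : List Rule) (u : Term 0), Steps ρs t u ∧ NF ν.toFallible u ∧ m = (ρs : Multiset Rule) := by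
  induction m using Multiset.strongInductionOn generalizing t with
  | ih m ih =>
    rcases Derivable.progress h rfl with ⟨ρ, t', hs⟩ | hv
    · obtain ⟨m', h', rfl⟩ := (hs.closedDerivable_iff).mp h
      rw [Multiset.singleton_add] at ih ⊢
      obtain ⟨ρs, u, hsu, hu, rfl⟩ := ih m' (Multiset.lt_cons_self m' ρ) h'
      exact ⟨ρ :: ρs, u, Steps.cons hs hsu, hu, rfl⟩
    · rw [Multitype.nature_empty] at hv
      exact ⟨[], t, Steps.nil t, nf_iff_isValueOf.mpr hv, hv.splittable.empty_iff.mp h⟩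

/-- The final value has the empty multitype of its nature with counter zero, and each expansion adds
the name of its step. -/
theorem Steps.closedDerivable {ρs : List Rule} {t u : Term 0} {ν : Nature} (h : Steps ρs t u)
    (hu : NF ν.toFallible u) : ClosedDerivable (ρs : Multiset Rule) t (.empty ν) := by
  induction h with
  | nil t => exact (nf_iff_isValueOf.mp hu).splittable.empty_iff.mpr rfl
  | cons hs _ ih => exact (hs.closedDerivable_iff).mpr ⟨_, ih hu, rfl⟩

end PCFH

theorem mainTheorem2 (t : PCFH.Term 0) (ν : PCFH.Nature) (m : PCFH.MultiCounter) :
    PCFH.TightDerivable PCFH.FamCtx.empty PCFH.TypCtx.empty m t (PCFH.Multitype.empty ν) ↔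
      ∃ (ρs : List PCFH.Rule) (u : PCFH.Term 0),
        PCFH.Steps ρs t u ∧ PCFH.NF ν.toFallible u ∧ m = (ρs : Multiset PCFH.Rule) := by
  constructor
  · intro h
    exact PCFH.ClosedDerivable.exists_steps h.1
  · rintro ⟨ρs, u, hs, hu, rfl⟩
    exact ⟨hs.closedDerivable hu, rfl, rfl, ν, rfl⟩
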